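/- Let $d\in\mathbb N$ and, for $k\in\mathbb Z^d$, $\|k\|_1=\sum_r|k_r|$. Let $u:\mathbb Z^d\to\mathbb R$ be a function that is not identically zero (its sign may change arbitrarily) and for which there are constants $C,\alpha>0$ with $$|u(k)|\le C e^{-\alpha\|k\|_1}\qquad\text{for all }k\in\mathbb Z^d. \tag{1}$$ For $\omega=(\omega_k)_{k\in\mathbb Z^d}$ let $h_\omega=h_0+v_\omega$ on $\ell^2(\mathbb Z^d)$, where $(h_0\psi)(x)=\sum_{\|x-y\|_1=1}(\psi(x)-\psi(y))$ and $v_\omega$ is multiplication by $v_\omega(x)=\sum_{k\in\mathbb Z^d}\omega_k u(x-k)$. For $l\ge 0$ put $\Lambda_l=[-l,l]^d\cap\mathbb Z^d$, and let $h_\omega^l=\pi_{\Lambda_l}h_\omega\iota_{\Lambda_l}$ be the restriction of $h_\omega$ to $\ell^2(\Lambda_l)$, where $\iota_{\Lambda_l}:\ell^2(\Lambda_l)\to\ell^2(\mathbb Z^d)$ is the inclusion and $\pi_{\Lambda_l}$ its adjoint. Let $P_I(h_\omega^l)$ denote the spectral projection of $h_\omega^l$ for the set $I\subset\mathbb R$.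 Let $F(z)=\sum_{k\in\mathbb Z^d}u(-k)z^k$, which is holomorphic near $\mathbf 1=(1,\dots,1)\in\mathbb C^d$. Call $I_0\in\mathbb N_0^d$ a leading index of $u$ if $(D^{I_0}_zF)(\mathbf 1)\ne0$ and $(D^{J}_zF)(\mathbf 1)=0$ for all $J\in\mathbb N_0^d$ with $J\le I_0$ componentwise and $J\neq I_0$. For such an $I_0$ put $c_u=(D^{I_0}_zF)(\mathbf 1)$, $N=\|I_0\|_1$ and, for $l>0$, $$R_l=\max\Bigl\{2l+\frac2\alpha\ln\frac{2\cdot3^d\,C}{|c_u|(1-e^{-\alpha/2})},\ \frac{8(d+N)^2}{\alpha^2}\Bigr\}.$$ Then $u$ has a leading index, and there is a constant $C_W>0$, depending only on $u$, with the following property. Let $C,\alpha>0$ be any constants satisfying (1), let $I_0$ be any leading index of $u$, and let $\mu$ be any probability measure on $\mathbb R$ with bounded support and a density $\rho\in BV(\mathbb R)$, that is, $\rho\in L^1(\mathbb R)$ and the distributional derivative of $\rho$ is a finite signed measure. Then for every $l>0$ and every bounded interval $I\subset\mathbb R$ we have, with $\Gamma=\Lambda_{R_l}$, $$\mathbb E_\Gamma\bigl\{\operatorname{Tr}P_I(h_\omega^l)\bigr\}\le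 C_W\,\|\rho\|_{\rm Var}\,|I|\,(2l+1)^{2d+N}.$$ Here $\|\rho\|_{\rm Var}=\sup\{\int_{\mathbb R}\rho v'\,dx: v\in C_c^\infty(\mathbb R),\ |v|\le1\}$, $|I|$ is the length of $I$, and $\mathbb E_\Gamma$ is the integral over $(\omega_k)_{k\in\Gamma}$ with respect to $\prod_{k\in\Gamma}\mu(d\omega_k)$, while the couplings $(\omega_k)_{k\notin\Gamma}$ are fixed, arbitrary real numbers for which all the series $v_\omega(x)$, $x\in\mathbb Z^d$, converge absolutely (for instance any bounded family, hence any family in $\operatorname{supp}\mu$). -/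

import Mathlib

open MeasureTheory

noncomputable section

namespace AlloyWegner

/-- The `ℓ¹`-norm `‖k‖₁ = ∑ᵣ |kᵣ|` of a lattice point. -/
def l1norm {d : ℕ} (k : Fin d → ℤ) : ℤ := ∑ i, |k i|

/-- The box `[-l, l]^d ∩ ℤ^d`, see `mem_box`. -/
def box (d : ℕ) (l : ℝ) : Finset (Fin d → ℤ) :=
  Fintype.piFinset fun _ => Finset.Icc ⌈-l⌉ ⌊l⌋

theorem mem_box {d : ℕ} {l : ℝ} {k : Fin d → ℤ} :
    k ∈ box d l ↔ ∀ i, (k i : ℝ) ∈ Set.Icc (-l) l := by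
  simp [box, Int.ceil_le, Int.le_floor]

/-- The nearest neighbours of `x` in `ℤ^d`, see `mem_neighbors`. -/
def neighbors {d : ℕ} (x : Fin d → ℤ) : Finset (Fin d → ℤ) :=
  (Fintype.piFinset fun i => Finset.Icc (x i - 1) (x i + 1)).filter fun y => l1norm (x - y) = 1

theorem mem_neighbors {d : ℕ} {x y : Fin d → ℤ} : y ∈ neighbors x ↔ l1norm (x - y) = 1 := by
  simp only [neighbors, Finset.mem_filter, Fintype.mem_piFinset, Finset.mem_Icc,
    and_iff_right_iff_imp]
  intro h i
  have hi : |(x - y) i| ≤ 1 := by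
    rw [← h]
    exact Finset.single_le_sum (f := fun j => |(x - y) j|) (fun j _ => abs_nonneg _)
      (Finset.mem_univ i)
  rw [Pi.sub_apply, abs_le] at hi
  omega

/-- The negative discrete Laplacian `(h₀ ψ)(x) = ∑_{‖x - y‖₁ = 1} (ψ x - ψ y)`. -/
def laplacian (d : ℕ) : ((Fin d → ℤ) → ℂ) →ₗ[ℂ] ((Fin d → ℤ) → ℂ) where
  toFun ψ x := ∑ y ∈ neighbors x, (ψ x - ψ y)
  map_add' ψ φ := by
    funext x
    simp only [Pi.add_apply, ← Finset.sum_add_distrib]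
    exact Finset.sum_congr rfl fun y _ => by ring
  map_smul' c ψ := by
    funext x
    simp only [Pi.smul_apply, smul_eq_mul, RingHom.id_apply, Finset.mul_sum]
    exact Finset.sum_congr rfl fun y _ => by ring

/-- The alloy-type potential `v_ω(x) = ∑ₖ ω_k u(x - k)`. -/
def potential {d : ℕ} (u ω : (Fin d → ℤ) → ℝ) (x : Fin d → ℤ) : ℝ := ∑' k, ω k * u (x - k)

/-- The operator `h_ω = h₀ + v_ω`, as a map on functions on `ℤ^d`. -/
def hamiltonian {d : ℕ} (u ω : (Fin d → ℤ) → ℝ) :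
    ((Fin d → ℤ) → ℂ) →ₗ[ℂ] ((Fin d → ℤ) → ℂ) where
  toFun ψ x := laplacian d ψ x + (potential u ω x : ℂ) * ψ x
  map_add' ψ φ := by
    funext x
    simp only [map_add, Pi.add_apply]
    ring
  map_smul' c ψ := by
    funext x
    simp only [map_smul, Pi.smul_apply, smul_eq_mul, RingHom.id_apply]
    ring

/-- The inclusion `ι_Λ` of `ℓ²(Λ)`: extension by zero. -/
def inclusion {d : ℕ} (Λ : Finset (Fin d → ℤ)) :
    EuclideanSpace ℂ Λ →ₗ[ℂ] ((Fin d → ℤ) → ℂ) where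
  toFun ψ x := if hx : x ∈ Λ then ψ ⟨x, hx⟩ else 0
  map_add' ψ φ := by
    funext x
    by_cases hx : x ∈ Λ <;> simp [hx]
  map_smul' c ψ := by
    funext x
    by_cases hx : x ∈ Λ <;> simp [hx]

/-- The restriction `π_Λ` to `Λ`. -/
def restriction {d : ℕ} (Λ : Finset (Fin d → ℤ)) :
    ((Fin d → ℤ) → ℂ) →ₗ[ℂ] EuclideanSpace ℂ Λ where
  toFun ψ := WithLp.toLp 2 fun x => ψ x
  map_add' _ _ := rfl
  map_smul' _ _ := rfl

/-- The finite volume operator `h_ω^Λ = π_Λ h_ω ι_Λ` on `ℓ²(Λ)`. -/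
def boxHamiltonian {d : ℕ} (u ω : (Fin d → ℤ) → ℝ) (Λ : Finset (Fin d → ℤ)) :
    EuclideanSpace ℂ Λ →ₗ[ℂ] EuclideanSpace ℂ Λ :=
  restriction Λ ∘ₗ hamiltonian u ω ∘ₗ inclusion Λ

/-- The spectral projection `P_B(T)` of a self-adjoint operator `T` on a finite-dimensional Hilbert
space: the orthogonal projection onto the span of the eigenspaces with eigenvalues in `B`. -/
def spectralProjection {E : Type*} [NormedAddCommGroup E] [InnerProductSpace ℂ E]
    [FiniteDimensional ℂ E] (T : E →ₗ[ℂ] E) (B : Set ℝ) : E →ₗ[ℂ] E :=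
  (⨆ e ∈ B, Module.End.eigenspace T (e : ℂ)).starProjection

/-- `Tr P_B(h_ω^Λ)`. -/
def traceProj {d : ℕ} (u ω : (Fin d → ℤ) → ℝ) (Λ : Finset (Fin d → ℤ)) (B : Set ℝ) : ℝ :=
  (LinearMap.trace ℂ _ (spectralProjection (boxHamiltonian u ω Λ) B)).re

/-- The configuration which is `η` on `Γ` and `ω` outside `Γ`. -/
def glue {d : ℕ} (Γ : Finset (Fin d → ℤ)) (η : Γ → ℝ) (ω : (Fin d → ℤ) → ℝ) :
    (Fin d → ℤ) → ℝ :=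
  fun k => if hk : k ∈ Γ then η ⟨k, hk⟩ else ω k

/-- Exponential decay with constants `C, α > 0`. -/
def ExpDecay {d : ℕ} (u : (Fin d → ℤ) → ℝ) (C α : ℝ) : Prop :=
  0 < C ∧ 0 < α ∧ ∀ k, |u k| ≤ C * Real.exp (-α * l1norm k)

/-- The generating function `F(z) = ∑ₖ u(-k) z^k`, whose series converges absolutely near
`(1, …, 1)` if `u` decays exponentially. -/
def genFun {d : ℕ} (u : (Fin d → ℤ) → ℝ) (z : Fin d → ℂ) : ℂ :=
  ∑' k : Fin d → ℤ, (u (-k) : ℂ) * ∏ i, z i ^ k i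

/-- The complex partial derivative `∂f/∂zᵢ`. -/
def partialDeriv {d : ℕ} (i : Fin d) (f : (Fin d → ℂ) → ℂ) (z : Fin d → ℂ) : ℂ :=
  deriv (fun w => f (Function.update z i w)) (z i)

/-- `D^I f = (∂/∂z₁)^{i₁} ⋯ (∂/∂z_d)^{i_d} f`. -/
def multiDeriv {d : ℕ} (I : Fin d → ℕ) (f : (Fin d → ℂ) → ℂ) : (Fin d → ℂ) → ℂ :=
  (List.finRange d).foldr (fun i g => (partialDeriv i)^[I i] g) f

/-- `(D^I F)(1, …, 1)` for the generating function `F` of `u`. -/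
def derivAtOne {d : ℕ} (u : (Fin d → ℤ) → ℝ) (I : Fin d → ℕ) : ℂ :=
  multiDeriv I (genFun u) 1

/-- `I₀` is a first non-vanishing derivative of the generating function at `(1, …, 1)`. (For
multi-indices, `J < I₀` means `J ≤ I₀` componentwise and `J ≠ I₀`.) -/
def IsLeadingIndex {d : ℕ} (u : (Fin d → ℤ) → ℝ) (I₀ : Fin d → ℕ) : Prop :=
  derivAtOne u I₀ ≠ 0 ∧ ∀ J, J < I₀ → derivAtOne u J = 0

/-- The radius `R_l`, with `c_u = (D^{I₀} F)(1, …, 1)`. -/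
def radius {d : ℕ} (u : (Fin d → ℤ) → ℝ) (C α : ℝ) (I₀ : Fin d → ℕ) (l : ℝ) : ℝ :=
  max (2 * l + 2 / α *
      Real.log (2 * 3 ^ d * C / (‖derivAtOne u I₀‖ * (1 - Real.exp (-α / 2)))))
    (8 * ((d : ℝ) + (∑ i, I₀ i : ℕ)) ^ 2 / α ^ 2)

/-- `ρ ∈ BV(ℝ)`: `ρ` is integrable and its distributional derivative is a finite signed measure. -/
def IsBV (ρ : ℝ → ℝ) : Prop :=
  Integrable ρ ∧ ∃ ν : SignedMeasure ℝ, ∀ φ : ℝ → ℝ,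
    ContDiff ℝ ((⊤ : ℕ∞) : WithTop ℕ∞) φ → HasCompactSupport φ →
    (∫ x, φ x ∂ν.toJordanDecomposition.posPart) - (∫ x, φ x ∂ν.toJordanDecomposition.negPart) =
      -∫ x, ρ x * deriv φ x

/-- `‖ρ‖_Var = sup {∫ ρ v' : v ∈ C_c^∞(ℝ), |v| ≤ 1}`. -/
def varNorm (ρ : ℝ → ℝ) : ℝ :=
  sSup {t | ∃ v : ℝ → ℝ, ContDiff ℝ ((⊤ : ℕ∞) : WithTop ℕ∞) v ∧ HasCompactSupport v ∧
    (∀ x, |v x| ≤ 1) ∧ t = ∫ x, ρ x * deriv v x}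

/-- `μ` has the density `ρ` with respect to Lebesgue measure. -/
def HasDensity (μ : Measure ℝ) (ρ : ℝ → ℝ) : Prop :=
  0 ≤ᵐ[volume] ρ ∧ μ = volume.withDensity fun x => ENNReal.ofReal (ρ x)

end AlloyWegner

end

open AlloyWegner

/-!
If `m` is a leading index of `u`, the translates `u (· - k)` weighted by the monomials `k ^ m` sum
to the nonzero constant `c_u`, whatever the signs of `u`. Exponential decay makes the tail beyond
`R_l` at most half of `c_u` on `Λ_l`, so shifting the couplings in `Γ` by `t` in the direction
`2 c_u⁻¹ k ^ m` raises the potential on `Λ_l` by at least `t`. By the min-max principle the number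
of eigenvalues in `I` is then at most the drop of an eigenvalue counting function under the shift
with `t = |I|`. The counting function is bounded by `|Λ_l|`, and for a product of `BV` densities
such a shift changes the expectation of a bounded function by at most its bound times `‖ρ‖_Var`
times the `ℓ¹`-length of the shift, which is of order `|I| (2l + 1) ^ (d + N)`.

A leading index exists because otherwise all moments of `u` vanish, and exponentially decaying
weights are determined by their moments. The leading indices form an antichain of `ℕ ^ d`, hence are
finitely many, which makes the constant depend on `u` only.
-/

noncomputable section

namespace AlloyWegner

/-! ### Counting eigenvalues of symmetric operators -/

theorem finrank_span_image_eq_ncard {K V ι : Type*} [DivisionRing K] [AddCommGroup V] [Module K V]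
    {v : ι → V} (hv : LinearIndependent K v) (S : Set ι) :
    Module.finrank K (Submodule.span K (v '' S)) = S.ncard := by
  rw [Module.finrank, rank_span_set (hv.linearIndepOn S).id_image,
    ← Set.ncard_image_of_injective S hv.injective]
  rfl

section SpectralCount

variable {𝕜 E : Type*} [RCLike 𝕜] [NormedAddCommGroup E] [InnerProductSpace 𝕜 E]

/-- The span of the eigenvectors of `T` whose eigenvalue lies in `B`, that is, the range of the
spectral projection of `T` for `B`. -/
def spectralSubspace (T : E →ₗ[𝕜] E) (B : Set ℝ) : Submodule 𝕜 E :=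
  ⨆ e ∈ B, Module.End.eigenspace T ((e : ℝ) : 𝕜)

/-- The number of eigenvalues of `T` in `B`, counted with multiplicity: the trace of the spectral
projection of `T` for `B`. -/
def spectralCount (T : E →ₗ[𝕜] E) (B : Set ℝ) : ℕ :=
  Module.finrank 𝕜 (spectralSubspace T B)

/-- The quadratic form `ψ ↦ ⟪ψ, T ψ⟫` of an operator, which the min-max principle compares. The
real part makes it real-valued; for symmetric `T` it discards nothing. -/
def quadForm (T : E →ₗ[𝕜] E) (ψ : E) : ℝ :=
  RCLike.re (inner 𝕜 ψ (T ψ))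

theorem norm_sq_eq_sum_norm_repr_sq {ι : Type*} [Fintype ι] (b : OrthonormalBasis ι 𝕜 E) (ψ : E) :
    ‖ψ‖ ^ 2 = ∑ i, ‖b.repr ψ i‖ ^ 2 := by
  rw [← b.repr.norm_map ψ, EuclideanSpace.norm_sq_eq]

theorem repr_eq_zero_of_mem_span_image {ι : Type*} [Fintype ι] (b : OrthonormalBasis ι 𝕜 E)
    {S : Set ι} {ψ : E} (hψ : ψ ∈ Submodule.span 𝕜 (b '' S)) {i : ι} (hi : i ∉ S) :
    b.repr ψ i = 0 := by
  rw [← b.coe_toBasis] at hψ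
  rw [← b.coe_toBasis_repr_apply]
  exact Finsupp.notMem_support_iff.1 fun h => hi (b.toBasis.mem_span_image.1 hψ h)

variable [FiniteDimensional 𝕜 E] {T : E →ₗ[𝕜] E}

theorem trace_spectralProjection {E : Type*} [NormedAddCommGroup E] [InnerProductSpace ℂ E]
    [FiniteDimensional ℂ E] (T : E →ₗ[ℂ] E) (B : Set ℝ) :
    LinearMap.trace ℂ _ (spectralProjection T B) = spectralCount T B :=
  LinearMap.IsProj.trace (p := spectralSubspace T B)
    ⟨fun x => Submodule.starProjection_apply_mem _ x,
      fun _ hx => Submodule.starProjection_eq_self_iff.2 hx⟩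

theorem spectralCount_le_finrank (T : E →ₗ[𝕜] E) (B : Set ℝ) :
    spectralCount T B ≤ Module.finrank 𝕜 E :=
  Submodule.finrank_le _

theorem spectralSubspace_eq_span (hT : T.IsSymmetric) (B : Set ℝ) :
    spectralSubspace T B =
      Submodule.span 𝕜 (hT.eigenvectorBasis rfl '' {i | hT.eigenvalues rfl i ∈ B}) := by
  apply le_antisymm
  · refine iSup₂_le fun e he ψ hψ => ?_
    rw [Module.End.mem_eigenspace_iff] at hψ
    rw [← (hT.eigenvectorBasis rfl).sum_repr ψ]
    refine Submodule.sum_mem _ fun i _ => ?_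
    by_cases hi : (hT.eigenvectorBasis rfl).repr ψ i = 0
    · simp [hi]
    have hcoord := hT.eigenvectorBasis_apply_self_apply rfl ψ i
    rw [hψ, map_smul, PiLp.smul_apply, smul_eq_mul] at hcoord
    have heigen : e = hT.eigenvalues rfl i := RCLike.ofReal_injective (mul_right_cancel₀ hi hcoord)
    exact Submodule.smul_mem _ _ (Submodule.subset_span ⟨i, by simpa [← heigen] using he, rfl⟩)
  · rw [Submodule.span_le]
    rintro _ ⟨i, hi, rfl⟩
    exact Submodule.mem_iSup_of_mem _ (Submodule.mem_iSup_of_mem hi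
      (hT.hasEigenvector_eigenvectorBasis rfl i).1)

theorem spectralCount_eq_ncard (hT : T.IsSymmetric) (B : Set ℝ) :
    spectralCount T B = {i | hT.eigenvalues rfl i ∈ B}.ncard := by
  rw [spectralCount, spectralSubspace_eq_span hT, finrank_span_image_eq_ncard
    (hT.eigenvectorBasis rfl).orthonormal.linearIndependent]

theorem quadForm_eq_sum (hT : T.IsSymmetric) (ψ : E) :
    quadForm T ψ = ∑ i, hT.eigenvalues rfl i * ‖(hT.eigenvectorBasis rfl).repr ψ i‖ ^ 2 := by
  rw [quadForm, ← (hT.eigenvectorBasis rfl).sum_inner_mul_inner, map_sum]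
  refine Finset.sum_congr rfl fun i _ => ?_
  have hcoord := hT.eigenvectorBasis_apply_self_apply rfl ψ i
  simp only [OrthonormalBasis.repr_apply_apply] at hcoord ⊢
  rw [hcoord, ← inner_conj_symm, mul_left_comm, RCLike.conj_mul]
  norm_cast

theorem finrank_le_spectralCount_Iio (hT : T.IsSymmetric) {b : ℝ} {W : Submodule 𝕜 E}
    (hW : ∀ ψ ∈ W, ψ ≠ 0 → quadForm T ψ < b * ‖ψ‖ ^ 2) :
    Module.finrank 𝕜 W ≤ spectralCount T (Set.Iio b) := by
  set V := Submodule.span 𝕜 (hT.eigenvectorBasis rfl '' {i | hT.eigenvalues rfl i < b}ᶜ) with hV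
  have hdisj : Disjoint W V := by
    refine Submodule.disjoint_def.2 fun ψ hψW hψV => by_contra fun hne => ?_
    have hlt := hW ψ hψW hne
    rw [quadForm_eq_sum hT, norm_sq_eq_sum_norm_repr_sq (hT.eigenvectorBasis rfl),
      Finset.mul_sum] at hlt
    refine absurd hlt (not_lt.2 (Finset.sum_le_sum fun i _ => ?_))
    by_cases hi : hT.eigenvalues rfl i < b
    · simp [repr_eq_zero_of_mem_span_image _ hψV (not_not.2 hi)]
    · gcongr
      exact not_lt.1 hi
  have hdim := Submodule.finrank_add_finrank_le_of_disjoint hdisj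
  rw [hV, finrank_span_image_eq_ncard (hT.eigenvectorBasis rfl).orthonormal.linearIndependent]
    at hdim
  have hcard := Set.ncard_add_ncard_compl {i | hT.eigenvalues rfl i < b}
  rw [Nat.card_fin] at hcard
  rw [spectralCount_eq_ncard hT]
  simp only [Set.mem_Iio]
  omega

theorem exists_pos_forall_le_sub_of_lt {ι : Type*} [Finite ι] (f : ι → ℝ) (b : ℝ) :
    ∃ ε > 0, ∀ i, f i < b → f i ≤ b - ε := by
  have hsmall : ∀ᶠ ε in nhdsWithin (0 : ℝ) (Set.Ioi 0), ∀ i, f i < b → f i ≤ b - ε := by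
    refine Filter.eventually_all.2 fun i => ?_
    by_cases hi : f i < b
    · filter_upwards [Ioo_mem_nhdsGT (sub_pos.2 hi)] with ε hε _
      linarith [hε.2]
    · simp [hi]
  obtain ⟨ε, hε, hpos⟩ := (hsmall.and self_mem_nhdsWithin).exists
  exact ⟨ε, hpos, hε⟩

theorem exists_quadForm_le_on_spectralSubspace_Iio (hT : T.IsSymmetric) (b : ℝ) :
    ∃ ε > 0, ∀ ψ ∈ spectralSubspace T (Set.Iio b), quadForm T ψ ≤ (b - ε) * ‖ψ‖ ^ 2 := by
  obtain ⟨ε, hεpos, hε⟩ := exists_pos_forall_le_sub_of_lt (hT.eigenvalues rfl) b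
  refine ⟨ε, hεpos, fun ψ hψ => ?_⟩
  rw [spectralSubspace_eq_span hT] at hψ
  rw [quadForm_eq_sum hT, norm_sq_eq_sum_norm_repr_sq (hT.eigenvectorBasis rfl), Finset.mul_sum]
  refine Finset.sum_le_sum fun i _ => ?_
  by_cases hi : hT.eigenvalues rfl i < b
  · gcongr
    exact hε i hi
  · simp [repr_eq_zero_of_mem_span_image _ hψ hi]

theorem spectralCount_Iio_le_of_quadForm_le {T' : E →ₗ[𝕜] E} (hT : T.IsSymmetric)
    (hT' : T'.IsSymmetric) {a b : ℝ}
    (h : ∀ ψ, quadForm T ψ + (b - a) * ‖ψ‖ ^ 2 ≤ quadForm T' ψ) :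
    spectralCount T' (Set.Iio b) ≤ spectralCount T (Set.Iio a) := by
  obtain ⟨ε, hε, hform⟩ := exists_quadForm_le_on_spectralSubspace_Iio hT' b
  refine finrank_le_spectralCount_Iio hT fun ψ hψ hne => ?_
  have hnorm : 0 < ‖ψ‖ ^ 2 := by positivity
  nlinarith [hform ψ hψ, h ψ]

theorem spectralCount_add_spectralCount_Iio_le (hT : T.IsSymmetric) {a b : ℝ} (hab : a ≤ b)
    {B : Set ℝ} (hB : B ⊆ Set.Ico a b) :
    spectralCount T B + spectralCount T (Set.Iio a) ≤ spectralCount T (Set.Iio b) := by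
  simp only [spectralCount_eq_ncard hT]
  rw [← Set.ncard_union_eq]
  · exact Set.ncard_le_ncard (Set.union_subset (fun i hi => (hB hi).2) fun i hi => hi.trans_le hab)
  · exact Set.disjoint_left.2 fun i hi hia => absurd (hB hi).1 (not_le.2 hia)

/-- The sum of the point masses at the eigenvalues of `T`, counted with multiplicity. Half-lines
determine a measure, so measurability in parameters of all counting functions follows from that of
`spectralCount T (Set.Iio b)`, which is lower semicontinuous. -/
def eigenvalueMeasure (hT : T.IsSymmetric) : Measure ℝ :=
  ∑ i, Measure.dirac (hT.eigenvalues rfl i)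

instance (hT : T.IsSymmetric) : IsFiniteMeasure (eigenvalueMeasure hT) := by
  unfold eigenvalueMeasure
  infer_instance

theorem eigenvalueMeasure_apply (hT : T.IsSymmetric) {B : Set ℝ} (hB : MeasurableSet B) :
    eigenvalueMeasure hT B = spectralCount T B := by
  classical
  simp [eigenvalueMeasure, Measure.dirac_apply' _ hB, spectralCount_eq_ncard hT,
    Set.indicator_apply, Set.ncard_eq_toFinset_card']

variable {X : Type*} [TopologicalSpace X] {S : X → E →ₗ[𝕜] E}

theorem eventually_quadForm_le (hcont : ∀ ψ, Continuous fun x => S x ψ) (x : X) {ε : ℝ}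
    (hε : 0 < ε) :
    ∀ᶠ y in nhds x, ∀ ψ, quadForm (S y) ψ ≤ quadForm (S x) ψ + ε * ‖ψ‖ ^ 2 := by
  have hS : Continuous fun x => (S x).toContinuousLinearMap := continuous_clm_apply.2 hcont
  filter_upwards [Metric.continuousAt_iff'.1 hS.continuousAt ε hε] with y hy ψ
  rw [dist_eq_norm] at hy
  have hdiff : quadForm (S y) ψ - quadForm (S x) ψ = RCLike.re
      (inner 𝕜 ψ (((S y).toContinuousLinearMap - (S x).toContinuousLinearMap) ψ)) := by
    simp [quadForm, inner_sub_right]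
  have hbound : quadForm (S y) ψ - quadForm (S x) ψ ≤ ε * ‖ψ‖ ^ 2 := calc
    _ ≤ ‖ψ‖ * ‖((S y).toContinuousLinearMap - (S x).toContinuousLinearMap) ψ‖ :=
      hdiff ▸ re_inner_le_norm _ _
    _ ≤ ‖ψ‖ * (ε * ‖ψ‖) := by gcongr; exact ContinuousLinearMap.le_of_opNorm_le _ hy.le ψ
    _ = ε * ‖ψ‖ ^ 2 := by ring
  linarith

theorem lowerSemicontinuous_spectralCount_Iio (hS : ∀ x, (S x).IsSymmetric)
    (hcont : ∀ ψ, Continuous fun x => S x ψ) (b : ℝ) :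
    LowerSemicontinuous fun x => spectralCount (S x) (Set.Iio b) := by
  intro x m hm
  obtain ⟨ε, hε, hform⟩ := exists_quadForm_le_on_spectralSubspace_Iio (hS x) b
  filter_upwards [eventually_quadForm_le hcont x (half_pos hε)] with y hy
  refine hm.trans_le (finrank_le_spectralCount_Iio (hS y) fun ψ hψ hne => ?_)
  have hnorm : 0 < ‖ψ‖ ^ 2 := by positivity
  nlinarith [hform ψ hψ, hy ψ]

theorem measurable_spectralCount [MeasurableSpace X] [BorelSpace X]
    (hS : ∀ x, (S x).IsSymmetric) (hcont : ∀ ψ, Continuous fun x => S x ψ)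
    {B : Set ℝ} (hB : MeasurableSet B) : Measurable fun x => (spectralCount (S x) B : ENNReal) := by
  have hmeas : Measurable fun x => eigenvalueMeasure (hS x) := by
    refine Measurable.measure_of_isPiSystem
      (borel_eq_generateFrom_Iio ℝ ▸ BorelSpace.measurable_eq) isPiSystem_Iio ?_ ?_
    · rintro _ ⟨b, rfl⟩
      simp only [eigenvalueMeasure_apply _ measurableSet_Iio]
      exact measurable_from_top.comp
        (lowerSemicontinuous_spectralCount_Iio hS hcont b).measurable
    · simp [eigenvalueMeasure_apply _ MeasurableSet.univ, spectralCount_eq_ncard (hS _)]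
  simpa only [eigenvalueMeasure_apply _ hB] using Measure.measurable_measure.1 hmeas B hB

end SpectralCount

/-! ### Translates of measures with a density of bounded variation -/

section SmoothApproximation

variable {X : Type*} [TopologicalSpace X] [WeaklyLocallyCompactSpace X] [NormalSpace X] [R1Space X]
  [MeasurableSpace X] [BorelSpace X]

theorem exists_continuous_integral_abs_sub_le {m : Measure X} [m.Regular] {g : X → ℝ}
    (hg : Integrable g m) {M : ℝ} (hM : ∀ x, |g x| ≤ M) (hM₀ : 0 ≤ M) {ε : ℝ} (hε : 0 < ε) :
    ∃ f : X → ℝ, Continuous f ∧ HasCompactSupport f ∧ (∀ x, |f x| ≤ M) ∧ Integrable f m ∧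
      ∫ x, |g x - f x| ∂m ≤ ε := by
  obtain ⟨k, hkc, hk, hkcont, hkint⟩ := hg.exists_hasCompactSupport_integral_sub_le hε
  let f : X → ℝ := fun x => max (-M) (min M (k x))
  have hfcont : Continuous f := by fun_prop
  have hfc : HasCompactSupport f :=
    hkc.comp_left (g := fun y => max (-M) (min M y)) (by simp [hM₀])
  have hfint : Integrable f m := hkint.mono hfcont.aestronglyMeasurable
    (Filter.Eventually.of_forall fun x => by simp only [Real.norm_eq_abs, f]; grind)
  refine ⟨f, hfcont, hfc, fun x => abs_le.2
    ⟨le_max_left _ _, max_le (by linarith) (min_le_left _ _)⟩, hfint, le_trans ?_ hk⟩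
  refine integral_mono (hg.sub hfint).abs (hg.sub hkint).norm fun x => ?_
  have hgx := abs_le.1 (hM x)
  simp only [f, Real.norm_eq_abs]
  grind

variable {E : Type*} [NormedAddCommGroup E] [NormedSpace ℝ E] [FiniteDimensional ℝ E]
  [MeasurableSpace E] [BorelSpace E]

theorem exists_contDiff_integral_abs_sub_le (m : Measure E) [IsFiniteMeasure m] {g : E → ℝ}
    (hg : Measurable g) {M : ℝ} (hM : ∀ x, |g x| ≤ M) {ε : ℝ} (hε : 0 < ε) :
    ∃ f : E → ℝ, ContDiff ℝ ((⊤ : ℕ∞) : WithTop ℕ∞) f ∧ HasCompactSupport f ∧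
      (∀ x, |f x| ≤ M + ε) ∧ ∫ x, |g x - f x| ∂m ≤ ε := by
  have hM₀ : 0 ≤ M := (abs_nonneg _).trans (hM 0)
  have hgint : Integrable g m := .of_bound hg.aestronglyMeasurable M (.of_forall hM)
  let δ := ε / (2 * (1 + m.real Set.univ))
  have hδ : 0 < δ := by positivity
  have hδε : δ * (1 + m.real Set.univ) = ε / 2 := by simp only [δ]; field_simp
  have := FiniteDimensional.proper_real E
  obtain ⟨k, hkcont, hkc, hkM, hkint, hgk⟩ := exists_continuous_integral_abs_sub_le hgint hM hM₀ hδ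
  obtain ⟨f, hf, hfk, hfs⟩ :=
    hkcont.exists_contDiff_approx ⊤ (ε := fun _ => δ) continuous_const fun _ => hδ
  have hfc : HasCompactSupport f := hkc.mono hfs
  have hkf (x : E) : |k x - f x| ≤ δ := by rw [abs_sub_comm]; exact (hfk x).le
  have hfint : Integrable f m := hf.continuous.integrable_of_hasCompactSupport hfc
  refine ⟨f, hf, hfc, fun x => ?_, ?_⟩
  · have := abs_sub_abs_le_abs_sub (f x) (k x)
    rw [abs_sub_comm] at this
    nlinarith [hkf x, hkM x, measureReal_nonneg (μ := m) (s := Set.univ)]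
  · calc ∫ x, |g x - f x| ∂m ≤ ∫ x, (|g x - k x| + δ) ∂m :=
          integral_mono (hgint.sub hfint).abs ((hgint.sub hkint).abs.add (integrable_const δ))
            fun x => (abs_sub_le _ (k x) _).trans (by gcongr; exact hkf x)
      _ = ∫ x, |g x - k x| ∂m + δ * m.real Set.univ := by
          rw [integral_add (f := fun x => |g x - k x|) (hgint.sub hkint).abs (integrable_const δ),
            integral_const, smul_eq_mul, mul_comm]
      _ ≤ ε := by linarith

theorem integral_sub_integral_le_of_forall_contDiff {μ ν : Measure E} [IsFiniteMeasure μ]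
    [IsFiniteMeasure ν] {K : ℝ}
    (h : ∀ (f : E → ℝ) (M : ℝ), ContDiff ℝ ((⊤ : ℕ∞) : WithTop ℕ∞) f → HasCompactSupport f →
      (∀ x, |f x| ≤ M) → ∫ x, f x ∂μ - ∫ x, f x ∂ν ≤ M * K)
    {g : E → ℝ} (hg : Measurable g) {M : ℝ} (hM : ∀ x, |g x| ≤ M) :
    ∫ x, g x ∂μ - ∫ x, g x ∂ν ≤ M * K := by
  have happrox : ∀ ε > 0, ∫ x, g x ∂μ - ∫ x, g x ∂ν ≤ (M + ε) * K + ε := by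
    intro ε hε
    obtain ⟨f, hf, hfc, hfM, hgf⟩ := exists_contDiff_integral_abs_sub_le (μ + ν) hg hM hε
    have hgi (m : Measure E) [IsFiniteMeasure m] : Integrable g m :=
      .of_bound hg.aestronglyMeasurable M (.of_forall hM)
    have hfi (m : Measure E) [IsFiniteMeasure m] : Integrable f m :=
      hf.continuous.integrable_of_hasCompactSupport hfc
    rw [integral_add_measure (f := fun x => |g x - f x|) ((hgi μ).sub (hfi μ)).abs
      ((hgi ν).sub (hfi ν)).abs] at hgf
    have hμ := abs_le.1 (abs_integral_le_integral_abs (f := fun x => g x - f x) (μ := μ))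
    have hν := abs_le.1 (abs_integral_le_integral_abs (f := fun x => g x - f x) (μ := ν))
    rw [integral_sub (hgi _) (hfi _)] at hμ hν
    linarith [h f _ hf hfc hfM]
  have hlim : Filter.Tendsto (fun ε => (M + ε) * K + ε) (nhdsWithin 0 (Set.Ioi 0))
      (nhds ((M + 0) * K + 0)) :=
    Filter.Tendsto.mono_left (Continuous.tendsto (by fun_prop) 0) nhdsWithin_le_nhds
  simpa using ge_of_tendsto hlim (Filter.eventually_of_mem self_mem_nhdsWithin happrox)

end SmoothApproximation

section BoundedVariation

variable {ρ : ℝ → ℝ}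

theorem IsBV.bddAbove_integral_mul_deriv (hρ : IsBV ρ) :
    BddAbove {t | ∃ v : ℝ → ℝ, ContDiff ℝ ((⊤ : ℕ∞) : WithTop ℕ∞) v ∧ HasCompactSupport v ∧
      (∀ x, |v x| ≤ 1) ∧ t = ∫ x, ρ x * deriv v x} := by
  obtain ⟨-, ν, hν⟩ := hρ
  refine ⟨ν.toJordanDecomposition.posPart.real Set.univ +
    ν.toJordanDecomposition.negPart.real Set.univ, ?_⟩
  rintro _ ⟨v, hv, hvc, hv1, rfl⟩
  have hbound (m : Measure ℝ) [IsFiniteMeasure m] : |∫ x, v x ∂m| ≤ m.real Set.univ := by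
    simpa using norm_integral_le_of_norm_le_const (μ := m) (f := v) (.of_forall hv1)
  linarith [hν v hv hvc, (abs_le.1 (hbound ν.toJordanDecomposition.posPart)).1,
    (abs_le.1 (hbound ν.toJordanDecomposition.negPart)).2]

theorem IsBV.varNorm_nonneg (hρ : IsBV ρ) : 0 ≤ varNorm ρ :=
  le_csSup hρ.bddAbove_integral_mul_deriv
    ⟨0, contDiff_const, HasCompactSupport.zero, by simp, by simp⟩

theorem IsBV.integral_mul_deriv_le (hρ : IsBV ρ) {v : ℝ → ℝ} {K : ℝ}
    (hv : ContDiff ℝ ((⊤ : ℕ∞) : WithTop ℕ∞) v) (hvc : HasCompactSupport v)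
    (hK : ∀ x, |v x| ≤ K) : ∫ x, ρ x * deriv v x ≤ K * varNorm ρ := by
  rcases ((abs_nonneg _).trans (hK 0)).eq_or_lt with rfl | hpos
  · have hv₀ : v = 0 := funext fun x => abs_nonpos_iff.1 (hK x)
    simp [hv₀]
  have hscaled : ∫ x, ρ x * deriv (fun y => K⁻¹ * v y) x ≤ varNorm ρ := by
    refine le_csSup hρ.bddAbove_integral_mul_deriv
      ⟨fun y => K⁻¹ * v y, contDiff_const.mul hv, hvc.mul_left, fun x => ?_, rfl⟩
    rw [abs_mul, abs_of_pos (inv_pos.2 hpos), inv_mul_le_iff₀ hpos, mul_one]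
    exact hK x
  have hderiv (x : ℝ) : ρ x * deriv (fun y => K⁻¹ * v y) x = K⁻¹ * (ρ x * deriv v x) := by
    rw [deriv_const_mul _ (hv.differentiable (by simp) x)]
    ring
  simp only [hderiv, integral_const_mul] at hscaled
  rwa [inv_mul_le_iff₀ hpos] at hscaled

theorem hasCompactSupport_intervalIntegral_add_const {g : ℝ → ℝ} (hg : HasCompactSupport g)
    (s : ℝ) : HasCompactSupport fun x => ∫ t in (x + s)..x, g t := by
  obtain ⟨R, hR⟩ := hg.isBounded.subset_closedBall 0
  refine .of_support_subset_isCompact (isCompact_closedBall (0 : ℝ) (R + |s|)) fun x hx => ?_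
  by_contra hxR
  refine hx (intervalIntegral.integral_zero_ae (Filter.Eventually.of_forall fun t ht => ?_))
  by_contra hgt
  have htR := hR (subset_tsupport g hgt)
  have hxt := Set.abs_sub_right_of_mem_uIcc (Set.uIoc_subset_uIcc ht)
  rw [sub_add_cancel_left, abs_neg] at hxt
  simp only [Metric.mem_closedBall, dist_zero_right, Real.norm_eq_abs, not_le] at htR hxR
  linarith [abs_sub_abs_le_abs_sub x t]

theorem exists_deriv_eq_sub_comp_add_const {g : ℝ → ℝ}
    (hg : ContDiff ℝ ((⊤ : ℕ∞) : WithTop ℕ∞) g) (hgc : HasCompactSupport g) {M : ℝ}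
    (hM : ∀ x, |g x| ≤ M) (s : ℝ) :
    ∃ v : ℝ → ℝ, ContDiff ℝ ((⊤ : ℕ∞) : WithTop ℕ∞) v ∧ HasCompactSupport v ∧
      (∀ x, |v x| ≤ M * |s|) ∧ ∀ x, deriv v x = g x - g (x + s) := by
  have hint (a b : ℝ) : IntervalIntegrable g volume a b := hg.continuous.intervalIntegrable a b
  have hprim (x : ℝ) : HasDerivAt (fun y => ∫ t in (0 : ℝ)..y, g t) (g x) x :=
    hg.continuous.integral_hasStrictDerivAt 0 x |>.hasDerivAt
  let v : ℝ → ℝ := fun x => ∫ t in (x + s)..x, g t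
  have hv (x : ℝ) : HasDerivAt v (g x - g (x + s)) x := by
    refine ((hprim x).sub ((hprim (x + s)).comp_add_const x s)).congr_of_eventuallyEq
      (.of_forall fun y => ?_)
    exact (intervalIntegral.integral_interval_sub_left (hint _ _) (hint _ _)).symm
  refine ⟨v, contDiff_infty_iff_deriv.2 ⟨fun x => (hv x).differentiableAt, ?_⟩,
    hasCompactSupport_intervalIntegral_add_const hgc s, fun x => ?_, fun x => (hv x).deriv⟩
  · rw [funext fun x => (hv x).deriv]
    exact hg.sub (hg.comp (contDiff_id.add contDiff_const))
  · simpa using intervalIntegral.norm_integral_le_of_norm_le_const (f := g) (a := x + s)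
      (b := x) fun t _ => hM t

theorem HasDensity.integral_eq {μ : Measure ℝ} (hμ : HasDensity μ ρ) (hρ : AEMeasurable ρ)
    (g : ℝ → ℝ) : ∫ x, g x ∂μ = ∫ x, ρ x * g x := by
  obtain ⟨hpos, rfl⟩ := hμ
  rw [integral_withDensity_eq_integral_toReal_smul₀ hρ.ennreal_ofReal
    (Filter.Eventually.of_forall fun _ => ENNReal.ofReal_lt_top)]
  refine integral_congr_ae ?_
  filter_upwards [hpos] with x hx
  rw [ENNReal.toReal_ofReal hx, smul_eq_mul]

variable {μ : Measure ℝ} [IsFiniteMeasure μ]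

theorem integral_sub_integral_comp_add_const_le_of_contDiff (hμ : HasDensity μ ρ) (hρ : IsBV ρ)
    {g : ℝ → ℝ} (hg : ContDiff ℝ ((⊤ : ℕ∞) : WithTop ℕ∞) g) (hgc : HasCompactSupport g)
    {M : ℝ} (hM : ∀ x, |g x| ≤ M) (s : ℝ) :
    ∫ x, g x ∂μ - ∫ x, g (x + s) ∂μ ≤ M * |s| * varNorm ρ := by
  obtain ⟨v, hv, hvc, hvM, hderiv⟩ := exists_deriv_eq_sub_comp_add_const hg hgc hM s
  calc ∫ x, g x ∂μ - ∫ x, g (x + s) ∂μ = ∫ x, deriv v x ∂μ := by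
        simp only [hderiv]
        exact (integral_sub (.of_bound hg.continuous.aestronglyMeasurable M (.of_forall hM))
          (.of_bound (by fun_prop) M (.of_forall fun x => hM (x + s)))).symm
    _ = ∫ x, ρ x * deriv v x := hμ.integral_eq hρ.1.aemeasurable _
    _ ≤ M * |s| * varNorm ρ := hρ.integral_mul_deriv_le hv hvc hvM

theorem integral_sub_integral_comp_add_const_le (hμ : HasDensity μ ρ) (hρ : IsBV ρ)
    {g : ℝ → ℝ} (hg : Measurable g) {M : ℝ} (hM : ∀ x, |g x| ≤ M) (s : ℝ) :
    ∫ x, g x ∂μ - ∫ x, g (x + s) ∂μ ≤ M * (|s| * varNorm ρ) := by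
  have hshift : AEMeasurable (fun x : ℝ => x + s) μ := by fun_prop
  rw [← integral_map hshift hg.aestronglyMeasurable]
  refine integral_sub_integral_le_of_forall_contDiff (fun f M hf hfc hfM => ?_) hg hM
  rw [integral_map hshift hf.continuous.aestronglyMeasurable, ← mul_assoc]
  exact integral_sub_integral_comp_add_const_le_of_contDiff hμ hρ hf hfc hfM s

theorem lintegral_le_lintegral_comp_add_const_add (hμ : HasDensity μ ρ) (hρ : IsBV ρ)
    {g : ℝ → ENNReal} (hg : Measurable g) {M : NNReal} (hM : ∀ x, g x ≤ M) (s : ℝ) :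
    ∫⁻ x, g x ∂μ ≤ ∫⁻ x, g (x + s) ∂μ + ENNReal.ofReal (M * (|s| * varNorm ρ)) := by
  have hreal := integral_sub_integral_comp_add_const_le hμ hρ hg.ennreal_toReal (M := M)
    (fun x => by simpa using ENNReal.toReal_mono ENNReal.coe_ne_top (hM x)) s
  have hlt (x : ℝ) : g x < ⊤ := (hM x).trans_lt ENNReal.coe_lt_top
  have hfin (f : ℝ → ENNReal) (hf : ∀ x, f x ≤ M) : ∫⁻ x, f x ∂μ ≠ ⊤ :=
    ((lintegral_mono hf).trans_lt (by simp [ENNReal.mul_lt_top])).ne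
  rw [integral_toReal hg.aemeasurable (.of_forall hlt), integral_toReal
    (f := fun x => g (x + s)) (hg.comp (measurable_add_const s)).aemeasurable
    (.of_forall fun x => hlt _)] at hreal
  rw [← ENNReal.ofReal_toReal (hfin g hM), ← ENNReal.ofReal_toReal (hfin _ fun x => hM (x + s)),
    ← ENNReal.ofReal_add ENNReal.toReal_nonneg (by have := hρ.varNorm_nonneg; positivity)]
  exact ENNReal.ofReal_le_ofReal (by linarith)

end BoundedVariation

section ProductShift

variable {ι : Type*} [Fintype ι] {μ : ι → Measure ℝ}
  [∀ i, IsProbabilityMeasure (μ i)] {M : ENNReal} {K : ι → ENNReal} {s : ι → ℝ}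

theorem lintegral_pi_le_lintegral_add_single [DecidableEq ι] {i : ι}
    (h : ∀ g : ℝ → ENNReal, Measurable g → (∀ x, g x ≤ M) →
      ∫⁻ x, g x ∂μ i ≤ ∫⁻ x, g (x + s i) ∂μ i + K i)
    {g : (ι → ℝ) → ENNReal} (hg : Measurable g) (hM : ∀ x, g x ≤ M) :
    ∫⁻ x, g x ∂Measure.pi μ ≤ ∫⁻ x, g (x + Pi.single i (s i)) ∂Measure.pi μ + K i := by
  suffices hmarg : ∫⁻ x, g x ∂Measure.pi μ ≤
      ∫⁻ x, (g (x + Pi.single i (s i)) + K i) ∂Measure.pi μ by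
    simpa [lintegral_add_right] using hmarg
  refine lintegral_le_of_lmarginal_le {i} hg (by fun_prop) fun x => ?_
  simp only [lmarginal_singleton]
  rw [lintegral_add_right _ measurable_const, lintegral_const, measure_univ, mul_one]
  convert h (fun t => g (Function.update x i t)) (hg.comp (measurable_update x))
    (fun t => hM _) using 5 with t
  ext j
  rcases eq_or_ne j i with rfl | hj <;> simp [*]

theorem lintegral_pi_le_lintegral_add
    (h : ∀ i, ∀ g : ℝ → ENNReal, Measurable g → (∀ x, g x ≤ M) →
      ∫⁻ x, g x ∂μ i ≤ ∫⁻ x, g (x + s i) ∂μ i + K i)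
    {g : (ι → ℝ) → ENNReal} (hg : Measurable g) (hM : ∀ x, g x ≤ M) :
    ∫⁻ x, g x ∂Measure.pi μ ≤ ∫⁻ x, g (x + s) ∂Measure.pi μ + ∑ i, K i := by
  classical
  suffices hpartial : ∀ S : Finset ι, ∫⁻ x, g x ∂Measure.pi μ ≤
      ∫⁻ x, g (x + ∑ i ∈ S, Pi.single i (s i)) ∂Measure.pi μ + ∑ i ∈ S, K i by
    simpa [Finset.univ_sum_single] using hpartial Finset.univ
  intro S
  induction S using Finset.induction_on with
  | empty => simp
  | insert i S hi ih =>
    rw [Finset.sum_insert hi, Finset.sum_insert hi, ← add_assoc]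
    refine ih.trans (add_le_add_left ?_ _)
    simpa only [add_assoc] using lintegral_pi_le_lintegral_add_single (h i)
      (g := fun x => g (x + ∑ j ∈ S, Pi.single j (s j))) (by fun_prop) fun x => hM _

end ProductShift

/-! ### A Wegner estimate for monotone families of operators -/

section MonotoneFamily

variable {𝕜 E ι : Type*} [RCLike 𝕜] [NormedAddCommGroup E] [InnerProductSpace 𝕜 E]
  [FiniteDimensional 𝕜 E] {S : (ι → ℝ) → E →ₗ[𝕜] E} {a : ι → ℝ}

theorem spectralCount_add_spectralCount_shift_le (hS : ∀ η, (S η).IsSymmetric)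
    (ha : ∀ η t ψ, 0 ≤ t → quadForm (S η) ψ + t * ‖ψ‖ ^ 2 ≤ quadForm (S (η + t • a)) ψ)
    {e₁ e₂ : ℝ} (he : e₁ ≤ e₂) {B : Set ℝ} (hB : B ⊆ Set.Ico e₁ e₂) (η : ι → ℝ) :
    spectralCount (S η) B + spectralCount (S (η + (e₂ - e₁) • a)) (Set.Iio e₂) ≤
      spectralCount (S η) (Set.Iio e₂) := by
  refine (Nat.add_le_add_left ?_ _).trans (spectralCount_add_spectralCount_Iio_le (hS η) he hB)
  exact spectralCount_Iio_le_of_quadForm_le (hS _) (hS _) fun ψ => ha η _ ψ (sub_nonneg.2 he)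

variable [Fintype ι] {μ : ι → Measure ℝ} [∀ i, IsProbabilityMeasure (μ i)] {ρ : ι → ℝ → ℝ}

theorem integrable_spectralCount (hS : ∀ η, (S η).IsSymmetric)
    (hcont : ∀ ψ, Continuous fun η => S η ψ) {B : Set ℝ} (hB : MeasurableSet B) :
    Integrable (fun η => (spectralCount (S η) B : ℝ)) (Measure.pi μ) := by
  have hmeas := (measurable_spectralCount hS hcont hB).ennreal_toReal
  simp only [ENNReal.toReal_natCast] at hmeas
  refine .of_bound hmeas.aestronglyMeasurable (Module.finrank 𝕜 E) (.of_forall fun η => ?_)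
  simpa using spectralCount_le_finrank (S η) B

theorem lintegral_spectralCount_le_of_subset_Ico (hμ : ∀ i, HasDensity (μ i) (ρ i))
    (hρ : ∀ i, IsBV (ρ i)) (hS : ∀ η, (S η).IsSymmetric) (hcont : ∀ ψ, Continuous fun η => S η ψ)
    (ha : ∀ η t ψ, 0 ≤ t → quadForm (S η) ψ + t * ‖ψ‖ ^ 2 ≤ quadForm (S (η + t • a)) ψ)
    {e₁ e₂ : ℝ} (he : e₁ ≤ e₂) {B : Set ℝ} (hB : B ⊆ Set.Ico e₁ e₂) :
    ∫⁻ η, spectralCount (S η) B ∂Measure.pi μ ≤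
      ENNReal.ofReal (Module.finrank 𝕜 E * (e₂ - e₁) * ∑ i, |a i| * varNorm (ρ i)) := by
  classical
  let G : (ι → ℝ) → ENNReal := fun η => spectralCount (S η) (Set.Iio e₂)
  have hG : Measurable G := measurable_spectralCount hS hcont measurableSet_Iio
  have hGM (η : ι → ℝ) : G η ≤ (Module.finrank 𝕜 E : NNReal) := by
    simpa [G] using spectralCount_le_finrank (S η) (Set.Iio e₂)
  have hGfin : ∫⁻ η, G (η + (e₂ - e₁) • a) ∂Measure.pi μ ≠ ⊤ :=
    ((lintegral_mono fun η => hGM _).trans_lt (by simp)).ne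
  have hconst : ∑ i, ENNReal.ofReal
        ((Module.finrank 𝕜 E : NNReal) * (|((e₂ - e₁) • a) i| * varNorm (ρ i))) =
      ENNReal.ofReal (Module.finrank 𝕜 E * (e₂ - e₁) * ∑ i, |a i| * varNorm (ρ i)) := by
    rw [← ENNReal.ofReal_sum_of_nonneg fun i _ => by have := (hρ i).varNorm_nonneg; positivity,
      Finset.mul_sum]
    simp [abs_mul, abs_of_nonneg (sub_nonneg.2 he), mul_assoc]
  rw [← ENNReal.add_le_add_iff_right hGfin, add_comm (ENNReal.ofReal _)]
  calc ∫⁻ η, spectralCount (S η) B ∂Measure.pi μ + ∫⁻ η, G (η + (e₂ - e₁) • a) ∂Measure.pi μ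
      = ∫⁻ η, (spectralCount (S η) B + G (η + (e₂ - e₁) • a)) ∂Measure.pi μ :=
        (lintegral_add_right _ (hG.comp (measurable_add_const _))).symm
    _ ≤ ∫⁻ η, G η ∂Measure.pi μ := lintegral_mono fun η => by
        simp only [G]
        exact_mod_cast spectralCount_add_spectralCount_shift_le hS ha he hB η
    _ ≤ _ := hconst ▸ lintegral_pi_le_lintegral_add (fun i g hg hgM =>
        lintegral_le_lintegral_comp_add_const_add (hμ i) (hρ i) hg hgM _) hG hGM

theorem integral_spectralCount_le_of_subset_Ico (hμ : ∀ i, HasDensity (μ i) (ρ i))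
    (hρ : ∀ i, IsBV (ρ i)) (hS : ∀ η, (S η).IsSymmetric) (hcont : ∀ ψ, Continuous fun η => S η ψ)
    (ha : ∀ η t ψ, 0 ≤ t → quadForm (S η) ψ + t * ‖ψ‖ ^ 2 ≤ quadForm (S (η + t • a)) ψ)
    {e₁ e₂ : ℝ} (he : e₁ ≤ e₂) {B : Set ℝ} (hBm : MeasurableSet B) (hB : B ⊆ Set.Ico e₁ e₂) :
    ∫ η, (spectralCount (S η) B : ℝ) ∂Measure.pi μ ≤
      Module.finrank 𝕜 E * (e₂ - e₁) * ∑ i, |a i| * varNorm (ρ i) := by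
  have hnonneg : 0 ≤ Module.finrank 𝕜 E * (e₂ - e₁) * ∑ i, |a i| * varNorm (ρ i) :=
    mul_nonneg (mul_nonneg (Nat.cast_nonneg _) (sub_nonneg.2 he))
      (Finset.sum_nonneg fun i _ => mul_nonneg (abs_nonneg _) (hρ i).varNorm_nonneg)
  rw [integral_eq_lintegral_of_nonneg_ae (.of_forall fun η => Nat.cast_nonneg _)
    (integrable_spectralCount hS hcont hBm).aestronglyMeasurable]
  simp only [ENNReal.ofReal_natCast]
  exact ENNReal.toReal_le_of_le_ofReal hnonneg
    (lintegral_spectralCount_le_of_subset_Ico hμ hρ hS hcont ha he hB)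

theorem exists_subset_Ico_sub_le_volume_add {I : Set ℝ} (hI : I.OrdConnected)
    (hIb : Bornology.IsBounded I) {ε : ℝ} (hε : 0 < ε) :
    ∃ e₁ e₂, e₁ ≤ e₂ ∧ I ⊆ Set.Ico e₁ e₂ ∧ e₂ - e₁ ≤ volume.real I + ε := by
  rcases I.eq_empty_or_nonempty with rfl | hne
  · exact ⟨0, 0, le_rfl, Set.empty_subset _, by simpa using hε.le⟩
  have hle := csInf_le_csSup hne hIb.bddBelow hIb.bddAbove
  have hvol : sSup I - sInf I ≤ volume.real I := by
    rw [← Real.volume_real_Ioo_of_le hle]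
    exact measureReal_mono (IsConnected.Ioo_csInf_csSup_subset ⟨hne, hI.isPreconnected⟩
      hIb.bddBelow hIb.bddAbove) hIb.measure_lt_top.ne
  exact ⟨sInf I, sSup I + ε, by linarith, fun y hy => ⟨csInf_le hIb.bddBelow hy,
    (le_csSup hIb.bddAbove hy).trans_lt (by linarith)⟩, by linarith⟩

theorem integral_spectralCount_le (hμ : ∀ i, HasDensity (μ i) (ρ i))
    (hρ : ∀ i, IsBV (ρ i)) (hS : ∀ η, (S η).IsSymmetric) (hcont : ∀ ψ, Continuous fun η => S η ψ)
    (ha : ∀ η t ψ, 0 ≤ t → quadForm (S η) ψ + t * ‖ψ‖ ^ 2 ≤ quadForm (S (η + t • a)) ψ)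
    {I : Set ℝ} (hI : I.OrdConnected) (hIb : Bornology.IsBounded I) :
    ∫ η, (spectralCount (S η) I : ℝ) ∂Measure.pi μ ≤
      Module.finrank 𝕜 E * volume.real I * ∑ i, |a i| * varNorm (ρ i) := by
  set V := ∑ i, |a i| * varNorm (ρ i)
  have hV : 0 ≤ V := Finset.sum_nonneg fun i _ => mul_nonneg (abs_nonneg _) (hρ i).varNorm_nonneg
  have hlim : Filter.Tendsto (fun ε : ℝ => Module.finrank 𝕜 E * (volume.real I + ε) * V)
      (nhdsWithin 0 (Set.Ioi 0)) (nhds (Module.finrank 𝕜 E * (volume.real I + 0) * V)) :=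
    Filter.Tendsto.mono_left (Continuous.tendsto (by fun_prop) 0) nhdsWithin_le_nhds
  rw [add_zero] at hlim
  refine ge_of_tendsto hlim (Filter.eventually_of_mem self_mem_nhdsWithin fun ε hε => ?_)
  obtain ⟨e₁, e₂, he, hsub, hlength⟩ := exists_subset_Ico_sub_le_volume_add hI hIb hε
  calc _ ≤ Module.finrank 𝕜 E * (e₂ - e₁) * V :=
        integral_spectralCount_le_of_subset_Ico hμ hρ hS hcont ha he hI.measurableSet hsub
    _ ≤ Module.finrank 𝕜 E * (volume.real I + ε) * V := by gcongr

end MonotoneFamily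

/-! ### Summability on the lattice -/

section LatticeSums

theorem summable_prod_apply {ι κ : Type*} [Fintype ι] {f : ι → κ → ℝ} (hf₀ : ∀ i n, 0 ≤ f i n)
    (hf : ∀ i, Summable (f i)) : Summable fun k : ι → κ => ∏ i, f i (k i) := by
  classical
  refine summable_of_sum_le (c := ∏ i, ∑' n, f i n)
    (fun k => Finset.prod_nonneg fun i _ => hf₀ i _) fun s => ?_
  calc ∑ k ∈ s, ∏ i, f i (k i)
      ≤ ∑ k ∈ Fintype.piFinset fun i => s.image fun k => k i, ∏ i, f i (k i) :=
        Finset.sum_le_sum_of_subset_of_nonneg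
          (fun k hk => Fintype.mem_piFinset.2 fun i => Finset.mem_image_of_mem _ hk)
          fun k _ _ => Finset.prod_nonneg fun i _ => hf₀ i _
    _ = ∏ i, ∑ n ∈ s.image fun k => k i, f i n := (Finset.prod_univ_sum _ _).symm
    _ ≤ ∏ i, ∑' n, f i n :=
        Finset.prod_le_prod (fun i _ => Finset.sum_nonneg fun n _ => hf₀ i n)
          fun i _ => (hf i).sum_le_tsum _ fun n _ => hf₀ i n

theorem summable_int_abs_add_pow_mul_exp {β : ℝ} (hβ : 0 < β) (m : ℕ) :
    Summable fun n : ℤ => (|(n : ℝ)| + m) ^ m * Real.exp (-β * |(n : ℝ)|) := by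
  have hnat : Summable fun n : ℕ => ((n : ℝ) + m) ^ m * Real.exp (-β * n) := by
    refine (((summable_nat_add_iff m).2 (Real.summable_pow_mul_exp_neg_nat_mul m hβ)).mul_left
      (Real.exp (β * m))).congr fun n => ?_
    rw [mul_left_comm, ← Real.exp_add]
    push_cast
    ring_nf
  rw [summable_int_iff_summable_nat_and_neg]
  constructor <;> simpa using hnat

variable {d : ℕ}

theorem cast_l1norm (k : Fin d → ℤ) : (l1norm k : ℝ) = ∑ i, |(k i : ℝ)| := by
  simp [l1norm]

theorem l1norm_neg (k : Fin d → ℤ) : l1norm (-k) = l1norm k := by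
  simp [l1norm]

/-- The weight `∏ᵢ (|kᵢ| + mᵢ)^{mᵢ}`, a bound of polynomial growth for the monomial `k^m` as well
as for the product of the falling factorials `kᵢ (kᵢ - 1) ⋯ (kᵢ - mᵢ + 1)`. -/
def polyWeight (m : Fin d → ℕ) (k : Fin d → ℤ) : ℝ := ∏ i, (|(k i : ℝ)| + m i) ^ m i

theorem summable_polyWeight_mul_exp {β : ℝ} (hβ : 0 < β) (m : Fin d → ℕ) :
    Summable fun k : Fin d → ℤ => polyWeight m k * Real.exp (-β * l1norm k) := by
  refine (summable_prod_apply
    (f := fun i (n : ℤ) => (|(n : ℝ)| + m i) ^ m i * Real.exp (-β * |(n : ℝ)|))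
    (fun i n => by positivity) fun i => summable_int_abs_add_pow_mul_exp hβ (m i)).congr fun k => ?_
  rw [Finset.prod_mul_distrib, polyWeight, cast_l1norm, Finset.mul_sum, Real.exp_sum]

variable {u : (Fin d → ℤ) → ℝ} {C α : ℝ}

theorem ExpDecay.abs_apply_neg_le (hu : ExpDecay u C α) (k : Fin d → ℤ) :
    |u (-k)| ≤ C * Real.exp (-α * l1norm k) := by
  simpa [l1norm_neg] using hu.2.2 (-k)

theorem ExpDecay.summable_apply_neg_mul (hu : ExpDecay u C α) {q : (Fin d → ℤ) → ℝ} {K β : ℝ}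
    (hβ : β < α) (m : Fin d → ℕ)
    (hq : ∀ k, |q k| ≤ K * polyWeight m k * Real.exp (β * l1norm k)) :
    Summable fun k => u (-k) * q k := by
  refine Summable.of_norm_bounded
    ((summable_polyWeight_mul_exp (sub_pos.2 hβ) m).mul_left (C * K)) fun k => ?_
  rw [norm_mul, Real.norm_eq_abs, Real.norm_eq_abs]
  calc |u (-k)| * |q k|
      ≤ C * Real.exp (-α * l1norm k) * (K * polyWeight m k * Real.exp (β * l1norm k)) :=
        mul_le_mul (hu.abs_apply_neg_le k) (hq k) (abs_nonneg _)
          (mul_nonneg hu.1.le (Real.exp_nonneg _))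
    _ = C * K * (polyWeight m k * Real.exp (-(α - β) * l1norm k)) := by
        rw [show -(α - β) * (l1norm k : ℝ) = -α * l1norm k + β * l1norm k by ring, Real.exp_add]
        ring

end LatticeSums

/-! ### Derivatives of the generating function -/

section GeneratingFunction

variable {d : ℕ} {u : (Fin d → ℤ) → ℝ} {C α : ℝ}

/-- The product of falling factorials `∏ᵢ kᵢ (kᵢ - 1) ⋯ (kᵢ - mᵢ + 1)`, the value of
`D^m z^k` at `𝟏`. -/
def fallingProd (m : Fin d → ℕ) (k : Fin d → ℤ) : ℝ :=
  ∏ i, (descPochhammer ℝ (m i)).eval (k i : ℝ)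

theorem fallingProd_add_single (m : Fin d → ℕ) (i : Fin d) (k : Fin d → ℤ) :
    fallingProd (m + Pi.single i 1) k = fallingProd m k * (k i - m i) := by
  have herase : ∏ j ∈ Finset.univ.erase i,
        (descPochhammer ℝ ((m + Pi.single i 1 : Fin d → ℕ) j)).eval (k j : ℝ) =
      ∏ j ∈ Finset.univ.erase i, (descPochhammer ℝ (m j)).eval (k j : ℝ) :=
    Finset.prod_congr rfl fun j hj => by simp [Finset.ne_of_mem_erase hj]
  rw [fallingProd, fallingProd, ← Finset.mul_prod_erase _ _ (Finset.mem_univ i), herase,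
    ← Finset.mul_prod_erase Finset.univ (fun j => (descPochhammer ℝ (m j)).eval (k j : ℝ))
      (Finset.mem_univ i), Pi.add_apply, Pi.single_eq_same, descPochhammer_succ_eval]
  ring

theorem abs_descPochhammer_eval_le (m : ℕ) (x : ℝ) :
    |(descPochhammer ℝ m).eval x| ≤ (|x| + m) ^ m := by
  rw [descPochhammer_eval_eq_prod_range, Finset.abs_prod]
  calc ∏ j ∈ Finset.range m, |x - j| ≤ ∏ _ ∈ Finset.range m, (|x| + m) := by
        refine Finset.prod_le_prod (fun _ _ => abs_nonneg _) fun _ hj => (abs_sub _ _).trans ?_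
        rw [Nat.abs_cast]
        gcongr
        exact (Finset.mem_range.1 hj).le
    _ = (|x| + m) ^ m := by simp

theorem abs_fallingProd_le (m : Fin d → ℕ) (k : Fin d → ℤ) :
    |fallingProd m k| ≤ polyWeight m k := by
  rw [fallingProd, Finset.abs_prod]
  exact Finset.prod_le_prod (fun _ _ => abs_nonneg _) fun i _ => abs_descPochhammer_eval_le _ _

/-- The annulus `e^{-r} < |w| < e^r`; the generating series of `u` converges on its `d`-th power
when `r < α`. -/
def annulus (r : ℝ) : Set ℂ := {w | Real.exp (-r) < ‖w‖ ∧ ‖w‖ < Real.exp r}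

theorem isOpen_annulus (r : ℝ) : IsOpen (annulus r) :=
  (isOpen_lt continuous_const continuous_norm).inter (isOpen_lt continuous_norm continuous_const)

theorem ne_zero_of_mem_annulus {r : ℝ} {w : ℂ} (hw : w ∈ annulus r) : w ≠ 0 :=
  norm_pos_iff.1 ((Real.exp_pos _).trans hw.1)

theorem norm_zpow_le_of_mem_annulus {r : ℝ} {w : ℂ} (hw : w ∈ annulus r) (n : ℤ) :
    ‖w ^ n‖ ≤ Real.exp (r * |(n : ℝ)|) := by
  have hpos : 0 < ‖w‖ := norm_pos_iff.2 (ne_zero_of_mem_annulus hw)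
  have hlog : |Real.log ‖w‖| ≤ r := abs_le.2
    ⟨((Real.lt_log_iff_exp_lt hpos).2 hw.1).le, ((Real.log_lt_iff_lt_exp hpos).2 hw.2).le⟩
  rw [norm_zpow, ← Real.exp_log hpos, ← Real.rpow_intCast, ← Real.exp_mul, Real.exp_le_exp]
  calc Real.log ‖w‖ * n ≤ |Real.log ‖w‖ * n| := le_abs_self _
    _ = |Real.log ‖w‖| * |(n : ℝ)| := abs_mul _ _
    _ ≤ r * |(n : ℝ)| := by gcongr

/-- The `k`-th term of the series `D^m F(z) = ∑ₖ u(-k) D^m z^k`. -/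
def derivTerm (u : (Fin d → ℤ) → ℝ) (m : Fin d → ℕ) (k : Fin d → ℤ) (z : Fin d → ℂ) : ℂ :=
  ((u (-k) * fallingProd m k : ℝ) : ℂ) * ∏ i, z i ^ (k i - m i)

theorem norm_prod_zpow_le {r : ℝ} (hr : 0 ≤ r) (m : Fin d → ℕ) (k : Fin d → ℤ) {z : Fin d → ℂ}
    (hz : ∀ i, z i ∈ annulus r) :
    ‖∏ i, z i ^ (k i - m i)‖ ≤ Real.exp (r * ∑ i, (m i : ℝ)) * Real.exp (r * l1norm k) := by
  rw [norm_prod, cast_l1norm, Finset.mul_sum, Finset.mul_sum, Real.exp_sum, Real.exp_sum,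
    ← Finset.prod_mul_distrib]
  refine Finset.prod_le_prod (fun _ _ => norm_nonneg _) fun i _ => ?_
  calc ‖z i ^ (k i - m i)‖ ≤ Real.exp (r * |((k i - m i : ℤ) : ℝ)|) :=
        norm_zpow_le_of_mem_annulus (hz i) _
    _ ≤ Real.exp (r * (m i + |(k i : ℝ)|)) := by
        gcongr
        simpa [add_comm] using abs_sub (k i : ℝ) (m i : ℝ)
    _ = _ := by rw [mul_add, Real.exp_add]

theorem norm_derivTerm_le (hu : ExpDecay u C α) {r : ℝ} (hr : 0 ≤ r) (m : Fin d → ℕ)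
    (k : Fin d → ℤ) {z : Fin d → ℂ} (hz : ∀ i, z i ∈ annulus r) :
    ‖derivTerm u m k z‖ ≤ C * Real.exp (r * ∑ i, (m i : ℝ)) *
      (polyWeight m k * Real.exp (-(α - r) * l1norm k)) := by
  have hweight : 0 ≤ polyWeight m k := (abs_nonneg _).trans (abs_fallingProd_le m k)
  have hC := hu.1
  rw [derivTerm, norm_mul, Complex.norm_real, Real.norm_eq_abs, abs_mul]
  calc |u (-k)| * |fallingProd m k| * ‖∏ i, z i ^ (k i - m i)‖
      ≤ C * Real.exp (-α * l1norm k) * polyWeight m k *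
          (Real.exp (r * ∑ i, (m i : ℝ)) * Real.exp (r * l1norm k)) := by
        gcongr
        exacts [hu.abs_apply_neg_le k, abs_fallingProd_le m k, norm_prod_zpow_le hr m k hz]
    _ = _ := by
        rw [show -(α - r) * (l1norm k : ℝ) = -α * l1norm k + r * l1norm k by ring, Real.exp_add]
        ring

theorem hasDerivAt_prod_zpow_update (n : Fin d → ℤ) (z : Fin d → ℂ) (i : Fin d) {w : ℂ}
    (hw : w ≠ 0) :
    HasDerivAt (fun w => ∏ j, Function.update z i w j ^ n j)
      (n i * ∏ j, Function.update z i w j ^ (n - Pi.single i 1 : Fin d → ℤ) j) w := by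
  have hsplit (n : Fin d → ℤ) (w : ℂ) : ∏ j, Function.update z i w j ^ n j =
      w ^ n i * ∏ j ∈ Finset.univ.erase i, z j ^ n j := by
    rw [← Finset.mul_prod_erase _ _ (Finset.mem_univ i), Function.update_self]
    congr 1
    exact Finset.prod_congr rfl fun j hj => by
      rw [Function.update_of_ne (Finset.ne_of_mem_erase hj)]
  have herase : ∏ j ∈ Finset.univ.erase i, z j ^ (n - Pi.single i 1 : Fin d → ℤ) j =
      ∏ j ∈ Finset.univ.erase i, z j ^ n j :=
    Finset.prod_congr rfl fun j hj => by simp [Finset.ne_of_mem_erase hj]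
  simp only [hsplit]
  rw [herase, Pi.sub_apply, Pi.single_eq_same]
  simpa only [mul_assoc] using (hasDerivAt_zpow (n i) w (.inl hw)).mul_const _

theorem hasDerivAt_derivTerm_update (u : (Fin d → ℤ) → ℝ) (m : Fin d → ℕ) (k : Fin d → ℤ)
    (z : Fin d → ℂ) (i : Fin d) {w : ℂ} (hw : w ≠ 0) :
    HasDerivAt (fun w => derivTerm u m k (Function.update z i w))
      (derivTerm u (m + Pi.single i 1) k (Function.update z i w)) w := by
  refine ((hasDerivAt_prod_zpow_update (fun j => k j - m j) z i hw).const_mul _).congr_deriv ?_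
  have hexp (j : Fin d) : ((fun j => k j - (m j : ℤ)) - Pi.single i 1 : Fin d → ℤ) j =
      k j - ((m + Pi.single i 1 : Fin d → ℕ) j : ℤ) := by
    by_cases hj : j = i
    · subst hj
      simp [sub_sub]
    · simp [hj]
  simp only [derivTerm, fallingProd_add_single, hexp]
  push_cast
  ring

theorem partialDeriv_eq_tsum_derivTerm (hu : ExpDecay u C α) (m : Fin d → ℕ) (i : Fin d)
    {f : (Fin d → ℂ) → ℂ} (hf : ∀ z, (∀ j, z j ∈ annulus (α / 2)) → f z = ∑' k, derivTerm u m k z)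
    {z : Fin d → ℂ} (hz : ∀ j, z j ∈ annulus (α / 2)) :
    partialDeriv i f z = ∑' k, derivTerm u (m + Pi.single i 1) k z := by
  have hα : 0 < α := hu.2.1
  have hmem : ∀ w ∈ annulus (α / 2), ∀ j, Function.update z i w j ∈ annulus (α / 2) := by
    intro w hw j
    by_cases hj : j = i
    · subst hj
      simpa using hw
    · simpa [hj] using hz j
  have hderiv := Complex.hasSum_deriv_of_summable_norm (U := annulus (α / 2))
    (F := fun k w => derivTerm u m k (Function.update z i w))
    ((summable_polyWeight_mul_exp (β := α - α / 2) (by linarith) m).mul_left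
      (C * Real.exp (α / 2 * ∑ i, (m i : ℝ))))
    (fun k w hw => (hasDerivAt_derivTerm_update u m k z i
      (ne_zero_of_mem_annulus hw)).differentiableAt.differentiableWithinAt)
    (isOpen_annulus _)
    (fun k w hw => norm_derivTerm_le hu (by positivity) m k (hmem w hw)) (hz i)
  have hlocal : (fun w => f (Function.update z i w)) =ᶠ[nhds (z i)]
      fun w => ∑' k, derivTerm u m k (Function.update z i w) := by
    filter_upwards [(isOpen_annulus (α / 2)).mem_nhds (hz i)] with w hw
    exact hf _ (hmem w hw)
  rw [partialDeriv, hlocal.deriv_eq, ← hderiv.tsum_eq]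
  refine tsum_congr fun k => ?_
  rw [(hasDerivAt_derivTerm_update u m k z i (ne_zero_of_mem_annulus (hz i))).deriv,
    Function.update_eq_self]

theorem iterate_partialDeriv_eq_tsum_derivTerm (hu : ExpDecay u C α) (m : Fin d → ℕ) (i : Fin d)
    {f : (Fin d → ℂ) → ℂ} (hf : ∀ z, (∀ j, z j ∈ annulus (α / 2)) → f z = ∑' k, derivTerm u m k z)
    (n : ℕ) {z : Fin d → ℂ} (hz : ∀ j, z j ∈ annulus (α / 2)) :
    (partialDeriv i)^[n] f z = ∑' k, derivTerm u (m + Pi.single i n) k z := by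
  induction n generalizing z with
  | zero => simpa using hf z hz
  | succ n ih =>
    rw [Function.iterate_succ_apply', partialDeriv_eq_tsum_derivTerm hu _ i (fun _ => ih) hz,
      add_assoc, ← Pi.single_add]

theorem foldr_partialDeriv_genFun (hu : ExpDecay u C α) (m : Fin d → ℕ) (L : List (Fin d))
    {z : Fin d → ℂ} (hz : ∀ j, z j ∈ annulus (α / 2)) :
    L.foldr (fun i g => (partialDeriv i)^[m i] g) (genFun u) z =
      ∑' k, derivTerm u (fun j => L.count j * m j) k z := by
  induction L generalizing z with
  | nil => simp [genFun, derivTerm, fallingProd]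
  | cons i L ih =>
    rw [List.foldr_cons, iterate_partialDeriv_eq_tsum_derivTerm hu _ i (fun _ => ih) (m i) hz]
    congr! 4 with k j
    by_cases hj : j = i
    · subst hj
      simp [add_mul]
    · simp [hj, List.count_cons_of_ne (Ne.symm hj)]

theorem multiDeriv_genFun (hu : ExpDecay u C α) (m : Fin d → ℕ) {z : Fin d → ℂ}
    (hz : ∀ j, z j ∈ annulus (α / 2)) :
    multiDeriv m (genFun u) z = ∑' k, derivTerm u m k z := by
  rw [multiDeriv, foldr_partialDeriv_genFun hu m _ hz]
  simp only [List.count_eq_one_of_mem (List.nodup_finRange d) (List.mem_finRange _), one_mul]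

/-- The factorial moment `∑ₖ u(-k) ∏ᵢ kᵢ (kᵢ - 1) ⋯ (kᵢ - mᵢ + 1)` of the weights `k ↦ u(-k)`; the
series converges absolutely if `u` decays exponentially. -/
def factorialMoment (u : (Fin d → ℤ) → ℝ) (m : Fin d → ℕ) : ℝ := ∑' k, u (-k) * fallingProd m k

theorem hasSum_factorialMoment (hu : ExpDecay u C α) (m : Fin d → ℕ) :
    HasSum (fun k => u (-k) * fallingProd m k) (factorialMoment u m) :=
  (hu.summable_apply_neg_mul (K := 1) hu.2.1 m fun k => by
    simpa using abs_fallingProd_le m k).hasSum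

theorem derivAtOne_eq_factorialMoment (hu : ExpDecay u C α) (m : Fin d → ℕ) :
    derivAtOne u m = factorialMoment u m := by
  have hone (j : Fin d) : (1 : Fin d → ℂ) j ∈ annulus (α / 2) := by simp [annulus, hu.2.1]
  simp [derivAtOne, multiDeriv_genFun hu m hone, factorialMoment, derivTerm, Complex.ofReal_tsum]

theorem factorialMoment_eq_zero_iff (hu : ExpDecay u C α) {m : Fin d → ℕ} :
    factorialMoment u m = 0 ↔ derivAtOne u m = 0 := by
  rw [derivAtOne_eq_factorialMoment hu, Complex.ofReal_eq_zero]

theorem exists_add_pow_eq_sum_descPochhammer (n : ℕ) (x : ℝ) :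
    ∃ b : ℕ → ℝ, b n = 1 ∧ ∀ y : ℝ, (x + y) ^ n =
      ∑ j ∈ Finset.range (n + 1), b j * (descPochhammer ℝ j).eval y := by
  induction n with
  | zero => exact ⟨fun _ => 1, rfl, fun y => by simp⟩
  | succ n ih =>
    obtain ⟨b, hb, hpow⟩ := ih
    -- `(x + y) (y)ⱼ = (x + j) (y)ⱼ + (y)ⱼ₊₁` for the falling factorials `(y)ⱼ`
    let stay : ℕ → ℝ := fun j => if j ≤ n then b j * (x + j) else 0
    let raise : ℕ → ℝ := fun j => if j = 0 then 0 else b (j - 1)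
    have hstay : stay (n + 1) = 0 := by simp [stay]
    have hraise : raise 0 = 0 := by simp [raise]
    refine ⟨fun j => stay j + raise j, by simp [stay, raise, hb], fun y => ?_⟩
    simp only [add_mul, Finset.sum_add_distrib]
    rw [Finset.sum_range_succ (fun j => stay j * _), Finset.sum_range_succ' (fun j => raise j * _),
      hstay, hraise, zero_mul, zero_mul, add_zero, add_zero, ← Finset.sum_add_distrib, pow_succ,
      hpow y, Finset.sum_mul]
    refine Finset.sum_congr rfl fun j hj => ?_
    have hstay_j : stay j = b j * (x + j) := if_pos (Nat.lt_succ_iff.1 (Finset.mem_range.1 hj))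
    have hraise_j : raise (j + 1) = b j := by simp [raise]
    rw [hstay_j, hraise_j, descPochhammer_succ_eval]
    ring

theorem exists_prod_add_pow_eq_sum_fallingProd (m : Fin d → ℕ) (x : Fin d → ℤ) :
    ∃ b : (Fin d → ℕ) → ℝ, b m = 1 ∧ ∀ k : Fin d → ℤ, ∏ i, (((x + k) i : ℤ) : ℝ) ^ m i =
      ∑ J ∈ Finset.Iic m, b J * fallingProd J k := by
  choose b hb hpow using fun i => exists_add_pow_eq_sum_descPochhammer (m i) (x i : ℝ)
  refine ⟨fun J => ∏ i, b i (J i), by simp [hb], fun k => ?_⟩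
  have hIic : Finset.Iic m = Fintype.piFinset fun i => Finset.range (m i + 1) := by
    ext J
    simp [Pi.le_def]
  simp only [hIic, Pi.add_apply, Int.cast_add, hpow, Finset.prod_univ_sum, fallingProd,
    Finset.prod_mul_distrib]

theorem hasSum_apply_neg_mul_prod_add_pow (hu : ExpDecay u C α) {m : Fin d → ℕ}
    (hm : ∀ J < m, factorialMoment u J = 0) (x : Fin d → ℤ) :
    HasSum (fun k => u (-k) * ∏ i, (((x + k) i : ℤ) : ℝ) ^ m i) (factorialMoment u m) := by
  obtain ⟨b, hb, hprod⟩ := exists_prod_add_pow_eq_sum_fallingProd m x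
  have hsum : HasSum (fun k => ∑ J ∈ Finset.Iic m, b J * (u (-k) * fallingProd J k))
      (∑ J ∈ Finset.Iic m, b J * factorialMoment u J) :=
    hasSum_sum fun J _ => (hasSum_factorialMoment hu J).mul_left _
  have hval : ∑ J ∈ Finset.Iic m, b J * factorialMoment u J = factorialMoment u m := by
    rw [Finset.sum_eq_single_of_mem m (Finset.mem_Iic.2 le_rfl), hb, one_mul]
    intro J hJ hne
    rw [hm J (lt_of_le_of_ne (Finset.mem_Iic.1 hJ) hne), mul_zero]
  refine (hval ▸ hsum).congr_fun fun k => ?_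
  rw [hprod, Finset.mul_sum]
  exact Finset.sum_congr rfl fun J _ => mul_left_comm _ _ _

theorem IsLeadingIndex.factorialMoment_ne_zero {m : Fin d → ℕ} (hm : IsLeadingIndex u m)
    (hu : ExpDecay u C α) : factorialMoment u m ≠ 0 :=
  fun h => hm.1 ((factorialMoment_eq_zero_iff hu).1 h)

theorem IsLeadingIndex.hasSum_prod_pow_mul_apply_sub {m : Fin d → ℕ} (hm : IsLeadingIndex u m)
    (hu : ExpDecay u C α) (x : Fin d → ℤ) :
    HasSum (fun k : Fin d → ℤ => (∏ i, (k i : ℝ) ^ m i) * u (x - k)) (factorialMoment u m) := by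
  have hsum := hasSum_apply_neg_mul_prod_add_pow hu
    (fun J hJ => (factorialMoment_eq_zero_iff hu).2 (hm.2 J hJ)) x
  rw [← (Equiv.addLeft x).hasSum_iff]
  refine hsum.congr_fun fun k => ?_
  simp [mul_comm]

end GeneratingFunction

/-! ### Moments determine exponentially decaying weights -/

section MomentProblem

open ProbabilityTheory

variable {Ω : Type*} [MeasurableSpace Ω] {X : Ω → ℝ} {P Q : Measure Ω}

theorem iteratedDeriv_complexMGF_zero (hP : 0 ∈ interior (integrableExpSet X P)) (n : ℕ) :
    iteratedDeriv n (complexMGF X P) 0 = ((∫ ω, X ω ^ n ∂P : ℝ) : ℂ) := by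
  rw [iteratedDeriv_complexMGF (by simpa using hP), ← integral_complex_ofReal]
  simp

theorem eventuallyEq_complexMGF_of_moments_eq (hP : 0 ∈ interior (integrableExpSet X P))
    (hQ : 0 ∈ interior (integrableExpSet X Q))
    (hmoments : ∀ n : ℕ, ∫ ω, X ω ^ n ∂P = ∫ ω, X ω ^ n ∂Q) :
    complexMGF X P =ᶠ[nhds 0] complexMGF X Q := by
  have hPseries := (analyticAt_complexMGF (z := 0) (by simpa using hP)).hasFPowerSeriesAt
  have hQseries := (analyticAt_complexMGF (z := 0) (by simpa using hQ)).hasFPowerSeriesAt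
  simp only [iteratedDeriv_complexMGF_zero hP, hmoments] at hPseries
  simp only [iteratedDeriv_complexMGF_zero hQ] at hQseries
  have hsub := hPseries.sub hQseries
  rw [sub_self] at hsub
  filter_upwards [hsub.eventually_eq_zero] with z hz
  exact sub_eq_zero.1 hz

theorem complexMGF_eq_of_moments_eq (hP : 0 ∈ interior (integrableExpSet X P))
    (hQ : 0 ∈ interior (integrableExpSet X Q))
    (hmoments : ∀ n : ℕ, ∫ ω, X ω ^ n ∂P = ∫ ω, X ω ^ n ∂Q) {z : ℂ}
    (hzP : z.re ∈ interior (integrableExpSet X P)) (hzQ : z.re ∈ interior (integrableExpSet X Q)) :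
    complexMGF X P z = complexMGF X Q z := by
  let strip : Set ℂ :=
    {z | z.re ∈ interior (integrableExpSet X P) ∩ interior (integrableExpSet X Q)}
  have hstrip : IsPreconnected strip :=
    ((convex_integrableExpSet.interior.inter convex_integrableExpSet.interior).linear_preimage
      Complex.reLm).isPreconnected
  exact AnalyticOnNhd.eqOn_of_preconnected_of_eventuallyEq (U := strip) (z₀ := 0)
    (analyticOnNhd_complexMGF.mono fun z hz => hz.1)
    (analyticOnNhd_complexMGF.mono fun z hz => hz.2) hstrip (by simpa [strip] using ⟨hP, hQ⟩)
    (eventuallyEq_complexMGF_of_moments_eq hP hQ hmoments) ⟨hzP, hzQ⟩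

theorem sum_dirac_singleton {κ Y : Type*} [MeasurableSpace Y] [MeasurableSingletonClass Y]
    {x : κ → Y} (hx : Function.Injective x) (c : κ → ENNReal) (k : κ) :
    Measure.sum (fun k => c k • Measure.dirac (x k)) {x k} = c k := by
  rw [Measure.sum_apply _ (measurableSet_singleton _), tsum_eq_single k]
  · simp
  · intro j hj
    simp [hx.ne hj]

theorem tsum_max_zero_mul_eq_of_hasSum_zero {κ : Type*} {f a : κ → ℝ}
    (hf : HasSum (fun k => f k * a k) 0) :
    ∑' k, max (f k) 0 * a k = ∑' k, max (-f k) 0 * a k := by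
  have hmax {g : κ → ℝ} (hg : ∀ k, |g k| = |f k|) : Summable fun k => max (g k) 0 * a k := by
    refine Summable.of_norm_bounded hf.summable.abs fun k => ?_
    rw [Real.norm_eq_abs, abs_mul, abs_mul, ← hg, abs_of_nonneg (le_max_right _ _)]
    gcongr
    exact max_le (le_abs_self _) (abs_nonneg _)
  rw [← sub_eq_zero, ← (hmax fun _ => rfl).tsum_sub (hmax fun _ => abs_neg _)]
  simpa only [← sub_mul, max_zero_sub_eq_self] using hf.tsum_eq

theorem integrable_exp_mul_norm_sum_dirac {κ Y : Type*} [Countable κ] [NormedAddCommGroup Y]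
    [MeasurableSpace Y] [MeasurableSingletonClass Y] {x : κ → Y} {f : κ → ℝ} {ε : ℝ}
    (hf : Summable fun k => f k * Real.exp (ε * ‖x k‖)) :
    Integrable (fun y => Real.exp (ε * ‖y‖))
      (Measure.sum fun k => ENNReal.ofReal (f k) • Measure.dirac (x k)) := by
  refine integrable_sum_dirac (fun k => ENNReal.ofReal_ne_top)
    (Summable.of_nonneg_of_le (fun k => by positivity) (fun k => ?_) hf.abs)
  rw [Real.norm_eq_abs, abs_mul, ENNReal.toReal_ofReal']
  gcongr
  exact max_le (le_abs_self _) (abs_nonneg _)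

variable {E : Type*} [NormedAddCommGroup E] [InnerProductSpace ℝ E] [SecondCountableTopology E]
  [MeasurableSpace E] [BorelSpace E] {μ ν : Measure E} {ε : ℝ}

theorem integrable_exp_mul_inner (hμ : Integrable (fun x => Real.exp (ε * ‖x‖)) μ) (θ : E) {t : ℝ}
    (ht : |t| * ‖θ‖ ≤ ε) : Integrable (fun x => Real.exp (t * inner ℝ x θ)) μ := by
  refine hμ.mono' (by fun_prop) (.of_forall fun x => ?_)
  rw [Real.norm_eq_abs, Real.abs_exp, Real.exp_le_exp]
  calc t * inner ℝ x θ ≤ |t| * |inner ℝ x θ| := by rw [← abs_mul]; exact le_abs_self _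
    _ ≤ |t| * (‖x‖ * ‖θ‖) := by gcongr; exact abs_real_inner_le_norm x θ
    _ = |t| * ‖θ‖ * ‖x‖ := by ring
    _ ≤ ε * ‖x‖ := by gcongr

theorem zero_mem_interior_integrableExpSet_inner (hε : 0 < ε)
    (hμ : Integrable (fun x => Real.exp (ε * ‖x‖)) μ) (θ : E) :
    0 ∈ interior (integrableExpSet (fun x => inner ℝ x θ) μ) := by
  have hnear : ∀ᶠ t in nhds (0 : ℝ), |t| * ‖θ‖ < ε :=
    ContinuousAt.eventually_lt (by fun_prop) continuousAt_const (by simpa using hε)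
  exact mem_interior_iff_mem_nhds.2
    (hnear.mono fun t ht => integrable_exp_mul_inner hμ θ ht.le)

theorem isFiniteMeasure_of_integrable_exp_mul_norm (hε : 0 ≤ ε)
    (hμ : Integrable (fun x => Real.exp (ε * ‖x‖)) μ) : IsFiniteMeasure μ := by
  have hone : Integrable (fun _ : E => (1 : ℝ)) μ := by
    simpa using integrable_exp_mul_inner hμ 0 (t := 0) (by simpa using hε)
  exact (integrable_const_iff.1 hone).resolve_left one_ne_zero

theorem measure_ext_of_moments [CompleteSpace E] (hε : 0 < ε)
    (hμ : Integrable (fun x => Real.exp (ε * ‖x‖)) μ)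
    (hν : Integrable (fun x => Real.exp (ε * ‖x‖)) ν)
    (hmoments : ∀ (θ : E) (n : ℕ), ∫ x, inner ℝ x θ ^ n ∂μ = ∫ x, inner ℝ x θ ^ n ∂ν) : μ = ν := by
  have := isFiniteMeasure_of_integrable_exp_mul_norm hε.le hμ
  have := isFiniteMeasure_of_integrable_exp_mul_norm hε.le hν
  refine Measure.ext_of_charFun (funext fun θ => ?_)
  have hμθ := zero_mem_interior_integrableExpSet_inner hε hμ θ
  have hνθ := zero_mem_interior_integrableExpSet_inner hε hν θ
  simpa only [charFun_apply, complexMGF, mul_comm Complex.I] using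
    complexMGF_eq_of_moments_eq hμθ hνθ (hmoments θ) (z := Complex.I)
      (by simpa using hμθ) (by simpa using hνθ)

theorem eq_zero_of_moments_eq_zero [CompleteSpace E] {κ : Type*} [Countable κ] {x : κ → E}
    (hx : Function.Injective x) {f : κ → ℝ} (hε : 0 < ε)
    (hf : Summable fun k => f k * Real.exp (ε * ‖x k‖))
    (hmoments : ∀ (θ : E) (n : ℕ), HasSum (fun k => f k * inner ℝ (x k) θ ^ n) 0) : f = 0 := by
  have hmeasure : Measure.sum (fun k => ENNReal.ofReal (f k) • Measure.dirac (x k)) =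
      Measure.sum fun k => ENNReal.ofReal (-f k) • Measure.dirac (x k) := by
    refine measure_ext_of_moments hε (integrable_exp_mul_norm_sum_dirac hf)
      (integrable_exp_mul_norm_sum_dirac (by simpa using hf.neg)) fun θ n => ?_
    rw [integral_sum_dirac fun _ => ENNReal.ofReal_ne_top,
      integral_sum_dirac fun _ => ENNReal.ofReal_ne_top]
    simpa only [ENNReal.toReal_ofReal', smul_eq_mul] using
      tsum_max_zero_mul_eq_of_hasSum_zero (hmoments θ n)
  funext k
  have hk := congrArg (fun μ : Measure E => (μ {x k}).toReal) hmeasure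
  simp only [sum_dirac_singleton hx, ENNReal.toReal_ofReal'] at hk
  rw [← max_zero_sub_eq_self (f k), hk, sub_self, Pi.zero_apply]

end MomentProblem

/-! ### Existence and finiteness of leading indices -/

section LeadingIndex

theorem hasSum_mul_eval_zero {ι κ : Type*} [Fintype ι] {f : κ → ℝ} {x : κ → ι → ℝ}
    (h : ∀ m : ι → ℕ, HasSum (fun k => f k * ∏ i, x k i ^ m i) 0) (p : MvPolynomial ι ℝ) :
    HasSum (fun k => f k * MvPolynomial.eval (x k) p) 0 := by
  have hsum : HasSum (fun k => ∑ m ∈ p.support, p.coeff m * (f k * ∏ i, x k i ^ m i))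
      (∑ m ∈ p.support, p.coeff m * 0) := hasSum_sum fun m _ => (h m).mul_left _
  simp only [mul_zero, Finset.sum_const_zero] at hsum
  refine hsum.congr_fun fun k => ?_
  rw [MvPolynomial.eval_eq', Finset.mul_sum]
  exact Finset.sum_congr rfl fun m _ => mul_left_comm _ _ _

variable {d : ℕ} {u : (Fin d → ℤ) → ℝ} {C α : ℝ}

/-- The embedding of the lattice `ℤ^d` into Euclidean space, through which `u` becomes a measure
with exponential moments. -/
def latticePoint (k : Fin d → ℤ) : EuclideanSpace ℝ (Fin d) := WithLp.toLp 2 fun i => (k i : ℝ)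

theorem latticePoint_injective : Function.Injective (latticePoint (d := d)) := by
  intro k k' h
  funext i
  simpa [latticePoint] using congrArg (fun v : EuclideanSpace ℝ (Fin d) => v i) h

theorem norm_latticePoint_le (k : Fin d → ℤ) : ‖latticePoint k‖ ≤ l1norm k := by
  rw [cast_l1norm, EuclideanSpace.norm_eq]
  refine Real.sqrt_le_iff.2 ⟨Finset.sum_nonneg fun _ _ => abs_nonneg _, ?_⟩
  exact Finset.sum_sq_le_sq_sum_of_nonneg fun _ _ => abs_nonneg _

theorem ExpDecay.eq_zero_of_factorialMoment_eq_zero (hu : ExpDecay u C α)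
    (h : ∀ m, factorialMoment u m = 0) : u = 0 := by
  have hα := hu.2.1
  have hmonomial (m : Fin d → ℕ) : HasSum (fun k => u (-k) * ∏ i, (k i : ℝ) ^ m i) 0 := by
    simpa [h m] using hasSum_apply_neg_mul_prod_add_pow hu (m := m) (fun J _ => h J) 0
  have hsummable : Summable fun k => u (-k) * Real.exp (α / 2 * ‖latticePoint k‖) := by
    refine hu.summable_apply_neg_mul (K := 1) (half_lt_self hα) 0 fun k => ?_
    simpa [polyWeight, hα] using norm_latticePoint_le k
  have hreflect : (fun k => u (-k)) = 0 := by
    refine eq_zero_of_moments_eq_zero latticePoint_injective (half_pos hα) hsummable fun θ n => ?_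
    refine (hasSum_mul_eval_zero hmonomial
      ((∑ i, MvPolynomial.X i * MvPolynomial.C (θ i)) ^ n)).congr_fun fun k => ?_
    simp [latticePoint, PiLp.inner_apply, mul_comm]
  funext k
  simpa using congrFun hreflect (-k)

theorem exists_isLeadingIndex (hu₀ : u ≠ 0) (hu : ExpDecay u C α) :
    ∃ m, IsLeadingIndex u m := by
  have hne : {m | derivAtOne u m ≠ 0}.Nonempty := by
    by_contra! hempty
    refine hu₀ (hu.eq_zero_of_factorialMoment_eq_zero fun m => ?_)
    by_contra hm
    exact Set.eq_empty_iff_forall_notMem.1 hempty m fun h =>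
      hm ((factorialMoment_eq_zero_iff hu).2 h)
  obtain ⟨m, hm, hmin⟩ := wellFounded_lt.has_min _ hne
  exact ⟨m, hm, fun J hJ => by_contra fun hJ₀ => hmin J hJ₀ hJ⟩

-- Distinct leading indices are incomparable, so finiteness is Dickson's lemma.
theorem finite_setOf_isLeadingIndex (u : (Fin d → ℤ) → ℝ) : {m | IsLeadingIndex u m}.Finite :=
  WellQuasiOrderedLE.finite_of_isAntichain fun a ha _ hb hab hle =>
    ha.1 (hb.2 a (lt_of_le_of_ne hle hab))

end LeadingIndex

/-! ### Truncation of the moment sums -/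

section Truncation

theorem log_le_sqrt {x : ℝ} (hx : 0 < x) : Real.log x ≤ √x := by
  have hsqrt : 0 < √x := Real.sqrt_pos.2 hx
  have hlog := Real.log_le_sub_one_of_pos (half_pos hsqrt)
  rw [Real.log_div hsqrt.ne' two_ne_zero, Real.log_sqrt hx.le] at hlog
  linarith [Real.log_two_lt_d9]

theorem pow_le_exp_mul_half {α x : ℝ} {M : ℕ} (hα : 0 < α) (hx : 0 < x)
    (hMx : 8 * (M : ℝ) ^ 2 / α ^ 2 ≤ x) : x ^ M ≤ Real.exp (α * x / 2) := by
  have hsqrt : 2 * M / α ≤ √x := by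
    refine Real.le_sqrt_of_sq_le (le_trans ?_ hMx)
    rw [div_pow]
    gcongr
    nlinarith [sq_nonneg (M : ℝ)]
  rw [div_le_iff₀ hα] at hsqrt
  rw [← Real.exp_log hx, ← Real.exp_nat_mul, Real.exp_le_exp, Real.exp_log hx]
  calc (M : ℝ) * Real.log x ≤ M * √x := by gcongr; exact log_le_sqrt hx
    _ ≤ α * (√x * √x) / 2 := by nlinarith [Real.sqrt_nonneg x]
    _ = α * x / 2 := by rw [Real.mul_self_sqrt hx.le]

theorem sum_pow_le_of_forall_le {q : ℝ} (hq₀ : 0 ≤ q) (hq₁ : q < 1) {T : Finset ℕ} {n₀ : ℕ}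
    (hT : ∀ n ∈ T, n₀ ≤ n) : ∑ n ∈ T, q ^ n ≤ q ^ n₀ / (1 - q) := by
  refine le_trans ?_ (geom_sum_Ico_le_of_lt_one (m := n₀) (n := T.sup id + 1) hq₀ hq₁)
  refine Finset.sum_le_sum_of_subset_of_nonneg (fun n hn => ?_) fun n _ _ => by positivity
  exact Finset.mem_Ico.2 ⟨hT n hn, Nat.lt_succ_of_le (Finset.le_sup (f := id) hn)⟩

theorem norm_sum_sub_le_of_hasSum {κ E : Type*} [SeminormedAddCommGroup E] {f : κ → E} {a : E}
    {b : ℝ} (hf : HasSum f a) {B : Finset κ}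
    (htail : ∀ s : Finset κ, Disjoint s B → ∑ k ∈ s, ‖f k‖ ≤ b) : ‖∑ k ∈ B, f k - a‖ ≤ b := by
  classical
  refine le_of_tendsto (tendsto_const_nhds.sub hf).norm ?_
  filter_upwards [Filter.eventually_ge_atTop B] with s hs
  rw [norm_sub_rev, ← Finset.sum_sdiff hs, add_sub_cancel_right]
  exact (norm_sum_le _ _).trans (htail _ Finset.sdiff_disjoint)

variable {d : ℕ} {u : (Fin d → ℤ) → ℝ} {C α l R : ℝ} {m : Fin d → ℕ} {x : Fin d → ℤ}

/-- The sup norm of a lattice point, as a natural number so that it can index shells. -/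
def supNorm (k : Fin d → ℤ) : ℕ := Finset.univ.sup fun i => (k i).natAbs

theorem abs_le_supNorm (k : Fin d → ℤ) (i : Fin d) : |(k i : ℝ)| ≤ supNorm k := by
  rw [← Int.cast_abs, Int.abs_eq_natAbs, Int.cast_natCast, Nat.cast_le]
  exact Finset.le_sup (f := fun i => (k i).natAbs) (Finset.mem_univ i)

theorem supNorm_le_of_forall_abs_le {k : Fin d → ℤ} {r : ℝ} (hr : 0 ≤ r)
    (hk : ∀ i, |(k i : ℝ)| ≤ r) : (supNorm k : ℝ) ≤ r := by
  refine (Nat.le_floor_iff hr).1 (Finset.sup_le fun i _ => Nat.le_floor ?_)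
  simpa using hk i

theorem lt_supNorm_of_notMem_box {k : Fin d → ℤ} (hk : k ∉ box d R) : R < supNorm k := by
  by_contra! hle
  exact hk (mem_box.2 fun i => abs_le.1 ((abs_le_supNorm k i).trans hle))

theorem card_filter_supNorm_eq_le (s : Finset (Fin d → ℤ)) (n : ℕ) :
    (s.filter fun k => supNorm k = n).card ≤ (2 * n + 1) ^ d := by
  calc (s.filter fun k => supNorm k = n).card
      ≤ (Fintype.piFinset fun _ : Fin d => Finset.Icc (-n : ℤ) n).card := by
        refine Finset.card_le_card fun k hk => Fintype.mem_piFinset.2 fun i => ?_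
        have hki := abs_le_supNorm k i
        rw [(Finset.mem_filter.1 hk).2] at hki
        rw [Finset.mem_Icc, ← abs_le]
        exact_mod_cast hki
    _ = (2 * n + 1) ^ d := by
        rw [Fintype.card_piFinset_const, Int.card_Icc]
        congr 1
        omega

theorem sum_comp_supNorm_le (s : Finset (Fin d → ℤ)) {g : ℕ → ℝ} (hg : ∀ n, 0 ≤ g n) :
    ∑ k ∈ s, g (supNorm k) ≤ ∑ n ∈ s.image supNorm, (2 * n + 1) ^ d * g n := by
  rw [← Finset.sum_fiberwise_of_maps_to fun k hk => Finset.mem_image_of_mem supNorm hk]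
  refine Finset.sum_le_sum fun n _ => ?_
  calc ∑ k ∈ s with supNorm k = n, g (supNorm k)
      = (s.filter fun k => supNorm k = n).card * g n := by
        rw [Finset.sum_congr rfl fun k hk => by rw [(Finset.mem_filter.1 hk).2], Finset.sum_const,
          nsmul_eq_mul]
    _ ≤ (2 * n + 1) ^ d * g n := by
        gcongr
        · exact hg n
        · exact_mod_cast card_filter_supNorm_eq_le s n

theorem shell_card_mul_pow_mul_exp_le (hα : 0 < α) {M n : ℕ} (hn : 0 < n)
    (hMn : 8 * ((d : ℝ) + M) ^ 2 / α ^ 2 ≤ n) :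
    (2 * n + 1 : ℝ) ^ d * ((n : ℝ) ^ M * Real.exp (-α * n)) ≤ 3 ^ d * Real.exp (-α / 2) ^ n := by
  have hn₁ : (1 : ℝ) ≤ n := by exact_mod_cast hn
  have hpow : (n : ℝ) ^ (d + M) ≤ Real.exp (α * n / 2) :=
    pow_le_exp_mul_half hα (Nat.cast_pos.2 hn) (by push_cast; exact hMn)
  calc (2 * n + 1 : ℝ) ^ d * ((n : ℝ) ^ M * Real.exp (-α * n))
      ≤ (3 * n : ℝ) ^ d * ((n : ℝ) ^ M * Real.exp (-α * n)) := by
        gcongr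
        linarith
    _ = 3 ^ d * ((n : ℝ) ^ (d + M) * Real.exp (-α * n)) := by ring
    _ ≤ 3 ^ d * (Real.exp (α * n / 2) * Real.exp (-α * n)) := by gcongr
    _ = 3 ^ d * Real.exp (-α / 2) ^ n := by
        rw [← Real.exp_nat_mul, ← Real.exp_add]
        ring_nf

theorem sum_supNorm_pow_mul_exp_le (hα : 0 < α) {M : ℕ} (hR : 8 * ((d : ℝ) + M) ^ 2 / α ^ 2 ≤ R)
    {s : Finset (Fin d → ℤ)} (hs : ∀ k ∈ s, R < supNorm k) :
    ∑ k ∈ s, (supNorm k : ℝ) ^ M * Real.exp (-α * supNorm k) ≤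
      3 ^ d * (Real.exp (-α * R / 2) / (1 - Real.exp (-α / 2))) := by
  have hq : Real.exp (-α / 2) < 1 := Real.exp_lt_one_iff.2 (by linarith)
  have himage {n : ℕ} (hn : n ∈ s.image supNorm) : R < n := by
    obtain ⟨k, hk, rfl⟩ := Finset.mem_image.1 hn
    exact hs k hk
  have hR₀ : 0 ≤ R := le_trans (by positivity) hR
  calc ∑ k ∈ s, (supNorm k : ℝ) ^ M * Real.exp (-α * supNorm k)
      ≤ ∑ n ∈ s.image supNorm, (2 * n + 1 : ℝ) ^ d * ((n : ℝ) ^ M * Real.exp (-α * n)) :=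
        sum_comp_supNorm_le s (g := fun n => (n : ℝ) ^ M * Real.exp (-α * n))
          fun n => by positivity
    _ ≤ ∑ n ∈ s.image supNorm, 3 ^ d * Real.exp (-α / 2) ^ n :=
        Finset.sum_le_sum fun n hn => shell_card_mul_pow_mul_exp_le hα
          (Nat.cast_pos.1 (hR₀.trans_lt (himage hn))) (hR.trans (himage hn).le)
    _ = 3 ^ d * ∑ n ∈ s.image supNorm, Real.exp (-α / 2) ^ n := by rw [Finset.mul_sum]
    _ ≤ 3 ^ d * (Real.exp (-α / 2) ^ ⌈R⌉₊ / (1 - Real.exp (-α / 2))) := by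
        gcongr
        exact sum_pow_le_of_forall_le (Real.exp_nonneg _) hq fun n hn =>
          Nat.ceil_le.2 (himage hn).le
    _ ≤ 3 ^ d * (Real.exp (-α * R / 2) / (1 - Real.exp (-α / 2))) := by
        have hceil : ⌈R⌉₊ * (-α / 2) ≤ -α * R / 2 := by nlinarith [Nat.le_ceil R]
        rw [← Real.exp_nat_mul]
        gcongr

theorem abs_prod_pow_le (m : Fin d → ℕ) {k : Fin d → ℤ} {r : ℝ} (hk : ∀ i, |(k i : ℝ)| ≤ r) :
    |∏ i, (k i : ℝ) ^ m i| ≤ r ^ ∑ i, m i := by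
  rw [Finset.abs_prod, ← Finset.prod_pow_eq_pow_sum]
  refine Finset.prod_le_prod (fun _ _ => abs_nonneg _) fun i _ => ?_
  rw [abs_pow]
  exact pow_le_pow_left₀ (abs_nonneg _) (hk i) _

theorem supNorm_le_add_l1norm_sub (hl : 0 ≤ l) (hx : x ∈ box d l) (k : Fin d → ℤ) :
    (supNorm k : ℝ) ≤ l + l1norm (x - k) := by
  have hcoord (i : Fin d) : |(x i : ℝ) - k i| ≤ l1norm (x - k) := by
    rw [cast_l1norm]
    simpa using Finset.single_le_sum (f := fun i => |(((x - k) i : ℤ) : ℝ)|)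
      (fun _ _ => abs_nonneg _) (Finset.mem_univ i)
  have hl1 : (0 : ℝ) ≤ l1norm (x - k) := by
    rw [cast_l1norm]
    positivity
  refine supNorm_le_of_forall_abs_le (by positivity) fun i => ?_
  calc |(k i : ℝ)| = |(x i : ℝ) - (x i - k i)| := by rw [sub_sub_cancel]
    _ ≤ |(x i : ℝ)| + |(x i : ℝ) - k i| := abs_sub _ _
    _ ≤ l + l1norm (x - k) := add_le_add (abs_le.2 (mem_box.1 hx i)) (hcoord i)

theorem ExpDecay.abs_prod_pow_mul_apply_sub_le (hu : ExpDecay u C α) (m : Fin d → ℕ) (hl : 0 ≤ l)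
    (hx : x ∈ box d l) (k : Fin d → ℤ) :
    |(∏ i, (k i : ℝ) ^ m i) * u (x - k)| ≤
      C * Real.exp (α * l) * ((supNorm k : ℝ) ^ (∑ i, m i) * Real.exp (-α * supNorm k)) := by
  have hC := hu.1
  have hexp : -α * l1norm (x - k) ≤ α * l + -α * supNorm k := by
    nlinarith [supNorm_le_add_l1norm_sub hl hx k, hu.2.1]
  rw [abs_mul]
  calc |∏ i, (k i : ℝ) ^ m i| * |u (x - k)|
      ≤ (supNorm k : ℝ) ^ (∑ i, m i) * (C * Real.exp (α * l + -α * supNorm k)) := by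
        gcongr
        · exact abs_prod_pow_le m (abs_le_supNorm k)
        · exact (hu.2.2 _).trans (by gcongr)
    _ = _ := by
        rw [Real.exp_add]
        ring

theorem ExpDecay.exp_mul_exp_neg_radius_le (hu : ExpDecay u C α) (hm : derivAtOne u m ≠ 0)
    (l : ℝ) :
    Real.exp (α * l) * Real.exp (-α * radius u C α m l / 2) ≤
      ‖derivAtOne u m‖ * (1 - Real.exp (-α / 2)) / (2 * 3 ^ d * C) := by
  have hC := hu.1
  have hα := hu.2.1
  have hq : 0 < 1 - Real.exp (-α / 2) := sub_pos.2 (Real.exp_lt_one_iff.2 (by linarith))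
  set X := 2 * 3 ^ d * C / (‖derivAtOne u m‖ * (1 - Real.exp (-α / 2))) with hX_def
  have hX : 0 < X := by positivity
  have hR : 2 * l + 2 / α * Real.log X ≤ radius u C α m l := le_max_left _ _
  calc Real.exp (α * l) * Real.exp (-α * radius u C α m l / 2)
      = Real.exp (α * l + -α * radius u C α m l / 2) := (Real.exp_add _ _).symm
    _ ≤ Real.exp (-Real.log X) := by
        have hscale := mul_le_mul_of_nonneg_left hR (half_pos hα).le
        rw [mul_add, ← mul_assoc (α / 2) (2 / α), div_mul_div_cancel₀ two_ne_zero, div_self hα.ne',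
          one_mul] at hscale
        rw [Real.exp_le_exp]
        linarith
    _ = ‖derivAtOne u m‖ * (1 - Real.exp (-α / 2)) / (2 * 3 ^ d * C) := by
        rw [Real.exp_neg, Real.exp_log hX, hX_def, inv_div]

theorem ExpDecay.sum_abs_prod_pow_mul_apply_sub_le (hu : ExpDecay u C α)
    (hm : derivAtOne u m ≠ 0) (hl : 0 ≤ l) (hx : x ∈ box d l) {s : Finset (Fin d → ℤ)}
    (hs : Disjoint s (box d (radius u C α m l))) :
    ∑ k ∈ s, |(∏ i, (k i : ℝ) ^ m i) * u (x - k)| ≤ ‖derivAtOne u m‖ / 2 := by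
  have hC := hu.1
  have hα := hu.2.1
  have hq : 0 < 1 - Real.exp (-α / 2) := sub_pos.2 (Real.exp_lt_one_iff.2 (by linarith))
  calc ∑ k ∈ s, |(∏ i, (k i : ℝ) ^ m i) * u (x - k)|
      ≤ ∑ k ∈ s, C * Real.exp (α * l) *
          ((supNorm k : ℝ) ^ (∑ i, m i) * Real.exp (-α * supNorm k)) :=
        Finset.sum_le_sum fun k _ => hu.abs_prod_pow_mul_apply_sub_le m hl hx k
    _ ≤ C * Real.exp (α * l) *
          (3 ^ d * (Real.exp (-α * radius u C α m l / 2) / (1 - Real.exp (-α / 2)))) := by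
        rw [← Finset.mul_sum]
        gcongr
        exact sum_supNorm_pow_mul_exp_le hα (le_max_right _ _) fun k hk =>
          lt_supNorm_of_notMem_box (Finset.disjoint_left.1 hs hk)
    _ = 3 ^ d * C / (1 - Real.exp (-α / 2)) *
          (Real.exp (α * l) * Real.exp (-α * radius u C α m l / 2)) := by ring
    _ ≤ 3 ^ d * C / (1 - Real.exp (-α / 2)) *
          (‖derivAtOne u m‖ * (1 - Real.exp (-α / 2)) / (2 * 3 ^ d * C)) := by
        gcongr
        exact hu.exp_mul_exp_neg_radius_le hm l
    _ = ‖derivAtOne u m‖ / 2 := by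
        generalize 1 - Real.exp (-α / 2) = q at hq
        field_simp

theorem IsLeadingIndex.abs_sum_box_sub_le (hm : IsLeadingIndex u m) (hu : ExpDecay u C α)
    (hl : 0 ≤ l) (hx : x ∈ box d l) :
    |∑ k ∈ box d (radius u C α m l), (∏ i, (k i : ℝ) ^ m i) * u (x - k) - factorialMoment u m| ≤
      |factorialMoment u m| / 2 := by
  have hnorm : ‖derivAtOne u m‖ = |factorialMoment u m| := by
    rw [derivAtOne_eq_factorialMoment hu, Complex.norm_real, Real.norm_eq_abs]
  rw [← hnorm]
  exact norm_sum_sub_le_of_hasSum (hm.hasSum_prod_pow_mul_apply_sub hu x) fun s hs =>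
    hu.sum_abs_prod_pow_mul_apply_sub_le hm.1 hl hx hs

end Truncation

/-! ### Finite volume operators -/

section BoxHamiltonian

variable {d : ℕ} {u ω : (Fin d → ℤ) → ℝ} {Λ Γ : Finset (Fin d → ℤ)}

theorem mem_neighbors_comm {x y : Fin d → ℤ} : y ∈ neighbors x ↔ x ∈ neighbors y := by
  rw [mem_neighbors, mem_neighbors, ← l1norm_neg, neg_sub]

theorem inclusion_apply_coe (ψ : EuclideanSpace ℂ Λ) (x : Λ) : inclusion Λ ψ x = ψ x := by
  simp [inclusion]

theorem inclusion_apply_of_notMem (ψ : EuclideanSpace ℂ Λ) {x : Fin d → ℤ} (hx : x ∉ Λ) :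
    inclusion Λ ψ x = 0 := by
  simp [inclusion, hx]

theorem sum_inclusion_apply (ψ : EuclideanSpace ℂ Λ) (s : Finset (Fin d → ℤ)) :
    ∑ y ∈ s, inclusion Λ ψ y = ∑ y : Λ, if (y : Fin d → ℤ) ∈ s then ψ y else 0 := by
  simp only [← inclusion_apply_coe]
  rw [Finset.sum_coe_sort Λ fun y => if y ∈ s then inclusion Λ ψ y else 0, Finset.sum_ite_mem]
  refine (Finset.sum_subset Finset.inter_subset_right fun y hys hy => ?_).symm
  exact inclusion_apply_of_notMem ψ fun hyΛ => hy (Finset.mem_inter.2 ⟨hyΛ, hys⟩)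

theorem boxHamiltonian_apply (u ω : (Fin d → ℤ) → ℝ) (ψ : EuclideanSpace ℂ Λ) (x : Λ) :
    boxHamiltonian u ω Λ ψ x =
      (neighbors (x : Fin d → ℤ)).card * ψ x -
        (∑ y : Λ, if (y : Fin d → ℤ) ∈ neighbors (x : Fin d → ℤ) then ψ y else 0) +
        potential u ω x * ψ x := by
  change ∑ y ∈ neighbors (x : Fin d → ℤ), (inclusion Λ ψ x - inclusion Λ ψ y) +
    (potential u ω x : ℂ) * inclusion Λ ψ x = _
  rw [Finset.sum_sub_distrib, Finset.sum_const, nsmul_eq_mul, sum_inclusion_apply,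
    inclusion_apply_coe]

theorem isSymmetric_boxHamiltonian (u ω : (Fin d → ℤ) → ℝ) (Λ : Finset (Fin d → ℤ)) :
    (boxHamiltonian u ω Λ).IsSymmetric := by
  intro ψ φ
  simp only [PiLp.inner_apply, RCLike.inner_apply, boxHamiltonian_apply, map_add, map_sub, map_mul,
    map_sum, map_natCast, Complex.conj_ofReal, mul_add, mul_sub, add_mul, sub_mul,
    Finset.sum_add_distrib, Finset.sum_sub_distrib, Finset.mul_sum, Finset.sum_mul]
  congr 2
  · exact Finset.sum_congr rfl fun x _ => by ring
  · rw [Finset.sum_comm]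
    refine Finset.sum_congr rfl fun x _ => Finset.sum_congr rfl fun y _ => ?_
    simp only [mem_neighbors_comm (x := (y : Fin d → ℤ))]
    split_ifs <;> simp
  · ext x
    ring

theorem quadForm_boxHamiltonian_sub (u ω ω' : (Fin d → ℤ) → ℝ) (ψ : EuclideanSpace ℂ Λ) :
    quadForm (boxHamiltonian u ω' Λ) ψ - quadForm (boxHamiltonian u ω Λ) ψ =
      ∑ x : Λ, (potential u ω' x - potential u ω x) * ‖ψ x‖ ^ 2 := by
  rw [quadForm, quadForm, ← map_sub, ← inner_sub_right, PiLp.inner_apply, map_sum]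
  refine Finset.sum_congr rfl fun x _ => ?_
  rw [PiLp.sub_apply, boxHamiltonian_apply, boxHamiltonian_apply, add_sub_add_left_eq_sub,
    ← sub_mul, RCLike.inner_apply, mul_assoc, Complex.mul_conj, ← Complex.ofReal_sub,
    ← Complex.ofReal_mul, RCLike.re_eq_complex_re, Complex.ofReal_re, Complex.normSq_eq_norm_sq]

theorem quadForm_boxHamiltonian_add_le {ω' : (Fin d → ℤ) → ℝ} {t : ℝ}
    (h : ∀ x ∈ Λ, potential u ω x + t ≤ potential u ω' x) (ψ : EuclideanSpace ℂ Λ) :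
    quadForm (boxHamiltonian u ω Λ) ψ + t * ‖ψ‖ ^ 2 ≤ quadForm (boxHamiltonian u ω' Λ) ψ := by
  rw [← le_sub_iff_add_le', quadForm_boxHamiltonian_sub, EuclideanSpace.norm_sq_eq, Finset.mul_sum]
  gcongr with x
  exact le_sub_iff_add_le'.2 (h x x.2)

theorem potential_glue (hω : ∀ x, Summable fun k => ω k * u (x - k)) (η : Γ → ℝ)
    (x : Fin d → ℤ) :
    potential u (glue Γ η ω) x = potential u ω x + ∑ k : Γ, (η k - ω k) * u (x - k) := by
  have hsum : HasSum (fun k => (glue Γ η ω k - ω k) * u (x - k))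
      (∑ k ∈ Γ, (glue Γ η ω k - ω k) * u (x - k)) :=
    hasSum_sum_of_ne_finset_zero fun k hk => by simp [glue, hk]
  rw [← Finset.sum_coe_sort Γ] at hsum
  refine (((hω x).hasSum.add hsum).congr_fun fun k => ?_).tsum_eq.trans ?_
  · ring
  · simp [potential, glue]

theorem potential_glue_add_smul (hω : ∀ x, Summable fun k => ω k * u (x - k)) (η a : Γ → ℝ)
    (t : ℝ) (x : Fin d → ℤ) :
    potential u (glue Γ (η + t • a) ω) x =
      potential u (glue Γ η ω) x + t * ∑ k : Γ, a k * u (x - k) := by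
  rw [potential_glue hω, potential_glue hω, add_assoc, Finset.mul_sum, ← Finset.sum_add_distrib]
  simp only [Pi.add_apply, Pi.smul_apply, smul_eq_mul]
  congr 2 with k
  ring

theorem continuous_boxHamiltonian_glue (hω : ∀ x, Summable fun k => ω k * u (x - k))
    (ψ : EuclideanSpace ℂ Λ) :
    Continuous fun η : Γ → ℝ => boxHamiltonian u (glue Γ η ω) Λ ψ := by
  have hcoord (x : Λ) : Continuous fun η : Γ → ℝ => boxHamiltonian u (glue Γ η ω) Λ ψ x := by
    simp only [boxHamiltonian_apply, potential_glue hω]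
    fun_prop
  exact (PiLp.continuous_toLp 2 _).comp (continuous_pi hcoord)

theorem traceProj_eq_spectralCount (u ω : (Fin d → ℤ) → ℝ) (Λ : Finset (Fin d → ℤ))
    (B : Set ℝ) : traceProj u ω Λ B = spectralCount (boxHamiltonian u ω Λ) B := by
  rw [traceProj, trace_spectralProjection, Complex.natCast_re]

variable {μ : Measure ℝ} [IsProbabilityMeasure μ] {ρ : ℝ → ℝ}

theorem integrable_traceProj (hω : ∀ x, Summable fun k => ω k * u (x - k)) {B : Set ℝ}
    (hB : MeasurableSet B) :
    Integrable (fun η : Γ → ℝ => traceProj u (glue Γ η ω) Λ B) (Measure.pi fun _ : Γ => μ) := by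
  simp only [traceProj_eq_spectralCount]
  exact integrable_spectralCount (fun η => isSymmetric_boxHamiltonian u _ Λ)
    (continuous_boxHamiltonian_glue hω) hB

theorem integral_traceProj_le (hμ : HasDensity μ ρ) (hρ : IsBV ρ)
    (hω : ∀ x, Summable fun k => ω k * u (x - k)) {a : Γ → ℝ}
    (ha : ∀ x ∈ Λ, 1 ≤ ∑ k : Γ, a k * u (x - k)) {I : Set ℝ} (hI : I.OrdConnected)
    (hIb : Bornology.IsBounded I) :
    ∫ η : Γ → ℝ, traceProj u (glue Γ η ω) Λ I ∂(Measure.pi fun _ : Γ => μ) ≤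
      Λ.card * volume.real I * ((∑ k, |a k|) * varNorm ρ) := by
  have hshift (η : Γ → ℝ) (t : ℝ) (ψ : EuclideanSpace ℂ Λ) (ht : 0 ≤ t) :
      quadForm (boxHamiltonian u (glue Γ η ω) Λ) ψ + t * ‖ψ‖ ^ 2 ≤
        quadForm (boxHamiltonian u (glue Γ (η + t • a) ω) Λ) ψ := by
    refine quadForm_boxHamiltonian_add_le (fun x hx => ?_) ψ
    rw [potential_glue_add_smul hω]
    gcongr
    exact le_mul_of_one_le_right ht (ha x hx)
  have hcount := integral_spectralCount_le (fun _ => hμ) (fun _ => hρ)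
    (fun η => isSymmetric_boxHamiltonian u _ Λ) (continuous_boxHamiltonian_glue hω) hshift hI hIb
  rwa [finrank_euclideanSpace, Fintype.card_coe, ← Finset.sum_mul,
    ← funext fun η : Γ → ℝ => traceProj_eq_spectralCount u (glue Γ η ω) Λ I] at hcount

end BoxHamiltonian

/-! ### The Wegner estimate for a leading index -/

section Wegner

theorem one_le_two_mul_inv_mul {c s : ℝ} (hc : c ≠ 0) (h : |s - c| ≤ |c| / 2) :
    1 ≤ 2 * c⁻¹ * s := by
  have hratio : |c⁻¹ * s - 1| ≤ 1 / 2 := by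
    calc |c⁻¹ * s - 1| = |c|⁻¹ * |s - c| := by
          rw [← abs_inv, ← abs_mul, mul_sub, inv_mul_cancel₀ hc]
      _ ≤ |c|⁻¹ * (|c| / 2) := by gcongr
      _ = 1 / 2 := by field_simp
  linarith [(abs_le.1 hratio).1]

theorem sum_coe_ite_mem {κ M : Type*} [DecidableEq κ] [AddCommMonoid M] {s t : Finset κ}
    (hst : s ⊆ t) (f : κ → M) : (∑ k : t, if (k : κ) ∈ s then f k else 0) = ∑ k ∈ s, f k := by
  rw [Finset.sum_coe_sort t fun k => if k ∈ s then f k else 0, Finset.sum_ite_mem,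
    Finset.inter_eq_right.2 hst]

variable {d : ℕ} {u ω : (Fin d → ℤ) → ℝ} {C α C₀ α₀ l R R' : ℝ} {m : Fin d → ℕ}

theorem box_mono (h : R ≤ R') : box d R ⊆ box d R' := fun _ hk =>
  mem_box.2 fun i => Set.Icc_subset_Icc (neg_le_neg h) h (mem_box.1 hk i)

theorem card_box_le (hl : 0 ≤ l) : ((box d l).card : ℝ) ≤ (2 * l + 1) ^ d := by
  have hfloor : 0 ≤ ⌊l⌋ := Int.floor_nonneg.2 hl
  have hside : (((⌊l⌋ + 1 - ⌈-l⌉).toNat : ℤ) : ℝ) = 2 * ⌊l⌋ + 1 := by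
    rw [Int.ceil_neg, Int.toNat_of_nonneg (by omega)]
    push_cast
    ring
  rw [box, Fintype.card_piFinset_const, Int.card_Icc, Nat.cast_pow, ← Int.cast_natCast, hside]
  gcongr
  exact Int.floor_le l

theorem sum_box_abs_prod_pow_le (m : Fin d → ℕ) (hR : 0 ≤ R) :
    ∑ k ∈ box d R, |∏ i, (k i : ℝ) ^ m i| ≤ (2 * R + 1) ^ d * R ^ ∑ i, m i := by
  calc ∑ k ∈ box d R, |∏ i, (k i : ℝ) ^ m i|
      ≤ ∑ _ ∈ box d R, R ^ ∑ i, m i :=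
        Finset.sum_le_sum fun _ hk => abs_prod_pow_le m fun i => abs_le.2 (mem_box.1 hk i)
    _ = (box d R).card * R ^ ∑ i, m i := by rw [Finset.sum_const, nsmul_eq_mul]
    _ ≤ (2 * R + 1) ^ d * R ^ ∑ i, m i := by
        gcongr
        exact card_box_le hR

theorem exists_radius_le_mul (u : (Fin d → ℤ) → ℝ) (C α : ℝ) (m : Fin d → ℕ) :
    ∃ K : ℝ, 1 ≤ K ∧ ∀ l : ℝ, 0 ≤ l → radius u C α m l ≤ K * (2 * l + 1) := by
  set A := 2 / α * Real.log (2 * 3 ^ d * C / (‖derivAtOne u m‖ * (1 - Real.exp (-α / 2))))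
    with hA
  set B := 8 * ((d : ℝ) + (∑ i, m i : ℕ)) ^ 2 / α ^ 2 with hB
  have hA₀ := abs_nonneg A
  have hB₀ := abs_nonneg B
  refine ⟨1 + |A| + |B|, by linarith, fun l hl => ?_⟩
  have hmul : 0 ≤ (|A| + |B|) * l := by positivity
  rw [radius, ← hA, ← hB]
  exact max_le (by linarith [le_abs_self A]) (by linarith [le_abs_self B])

/-- The direction in which the couplings are shifted: the translates of `u`, weighted by the
monomial `k ^ m` of a leading index `m`, sum to the constant `factorialMoment u m`. The factor `2`
compensates for the truncation to a box. -/
def leadingWeight (u : (Fin d → ℤ) → ℝ) (m : Fin d → ℕ) (k : Fin d → ℤ) : ℝ :=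
  2 * (factorialMoment u m)⁻¹ * ∏ i, (k i : ℝ) ^ m i

theorem IsLeadingIndex.one_le_sum_leadingWeight_mul (hm : IsLeadingIndex u m)
    (hu : ExpDecay u C α) (hl : 0 ≤ l) {x : Fin d → ℤ} (hx : x ∈ box d l) :
    1 ≤ ∑ k ∈ box d (radius u C α m l), leadingWeight u m k * u (x - k) := by
  simp only [leadingWeight, mul_assoc _ (∏ _, _), ← Finset.mul_sum]
  exact one_le_two_mul_inv_mul (hm.factorialMoment_ne_zero hu) (hm.abs_sum_box_sub_le hu hl hx)

theorem exists_sum_box_abs_leadingWeight_le (u : (Fin d → ℤ) → ℝ) (C α : ℝ) (m : Fin d → ℕ) :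
    ∃ W : ℝ, 0 ≤ W ∧ ∀ l : ℝ, 0 ≤ l →
      ∑ k ∈ box d (radius u C α m l), |leadingWeight u m k| ≤ W * (2 * l + 1) ^ (d + ∑ i, m i) := by
  obtain ⟨K, hK₁, hK⟩ := exists_radius_le_mul u C α m
  refine ⟨|2 * (factorialMoment u m)⁻¹| * ((3 * K) ^ d * K ^ ∑ i, m i), by positivity,
    fun l hl => ?_⟩
  have hL : 1 ≤ K * (2 * l + 1) := one_le_mul_of_one_le_of_one_le hK₁ (by linarith)
  simp only [leadingWeight, abs_mul _ (∏ _, _), ← Finset.mul_sum]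
  rw [mul_assoc]
  gcongr
  calc ∑ k ∈ box d (radius u C α m l), |∏ i, (k i : ℝ) ^ m i|
      ≤ ∑ k ∈ box d (K * (2 * l + 1)), |∏ i, (k i : ℝ) ^ m i| :=
        Finset.sum_le_sum_of_subset_of_nonneg (box_mono (hK l hl)) fun _ _ _ => abs_nonneg _
    _ ≤ (2 * (K * (2 * l + 1)) + 1) ^ d * (K * (2 * l + 1)) ^ ∑ i, m i :=
        sum_box_abs_prod_pow_le m (by linarith)
    _ ≤ (3 * (K * (2 * l + 1))) ^ d * (K * (2 * l + 1)) ^ ∑ i, m i := by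
        gcongr
        linarith
    _ = (3 * K) ^ d * K ^ (∑ i, m i) * (2 * l + 1) ^ (d + ∑ i, m i) := by
        simp only [mul_pow, pow_add]
        ring

variable {Γ : Finset (Fin d → ℤ)} {μ : Measure ℝ} [IsProbabilityMeasure μ] {ρ : ℝ → ℝ} {I : Set ℝ}

theorem IsLeadingIndex.integral_traceProj_le_sum_box (hm : IsLeadingIndex u m)
    (hu : ExpDecay u C α) (hμ : HasDensity μ ρ) (hρ : IsBV ρ) (hl : 0 ≤ l)
    (hI : I.OrdConnected) (hIb : Bornology.IsBounded I)
    (hω : ∀ x, Summable fun k => ω k * u (x - k)) (hΓ : box d (radius u C α m l) ⊆ Γ) :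
    ∫ η : Γ → ℝ, traceProj u (glue Γ η ω) (box d l) I ∂(Measure.pi fun _ : Γ => μ) ≤
      (box d l).card * volume.real I *
        ((∑ k ∈ box d (radius u C α m l), |leadingWeight u m k|) * varNorm ρ) := by
  let a (k : Γ) : ℝ :=
    if (k : Fin d → ℤ) ∈ box d (radius u C α m l) then leadingWeight u m k else 0
  have ha : ∀ x ∈ box d l, 1 ≤ ∑ k : Γ, a k * u (x - k) := fun x hx => by
    simp only [a, ite_mul, zero_mul]
    rw [sum_coe_ite_mem hΓ fun k => leadingWeight u m k * u (x - k)]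
    exact hm.one_le_sum_leadingWeight_mul hu hl hx
  have habs : ∑ k : Γ, |a k| = ∑ k ∈ box d (radius u C α m l), |leadingWeight u m k| := by
    simp only [a, apply_ite abs, abs_zero]
    exact sum_coe_ite_mem hΓ fun k => |leadingWeight u m k|
  rw [← habs]
  exact integral_traceProj_le hμ hρ hω ha hI hIb

/- Any decay constants may serve for the truncation, so the bound can be taken with fixed ones:
if their box does not fit into `Γ`, it contains the box that does. -/
theorem IsLeadingIndex.integral_traceProj_le_sum_box_of_expDecay (hm : IsLeadingIndex u m)
    (hu₀ : ExpDecay u C₀ α₀) (hu : ExpDecay u C α) (hμ : HasDensity μ ρ) (hρ : IsBV ρ)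
    (hl : 0 ≤ l) (hI : I.OrdConnected) (hIb : Bornology.IsBounded I)
    (hω : ∀ x, Summable fun k => ω k * u (x - k)) (hΓ : box d (radius u C α m l) ⊆ Γ) :
    ∫ η : Γ → ℝ, traceProj u (glue Γ η ω) (box d l) I ∂(Measure.pi fun _ : Γ => μ) ≤
      (box d l).card * volume.real I *
        ((∑ k ∈ box d (radius u C₀ α₀ m l), |leadingWeight u m k|) * varNorm ρ) := by
  rcases le_total (radius u C₀ α₀ m l) (radius u C α m l) with hle | hle
  · exact hm.integral_traceProj_le_sum_box hu₀ hμ hρ hl hI hIb hω ((box_mono hle).trans hΓ)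
  · have hvar := hρ.varNorm_nonneg
    refine (hm.integral_traceProj_le_sum_box hu hμ hρ hl hI hIb hω hΓ).trans ?_
    gcongr
    exact box_mono hle

theorem IsLeadingIndex.integral_traceProj_le_mul_pow (hm : IsLeadingIndex u m)
    (hu₀ : ExpDecay u C₀ α₀) {W : ℝ}
    (hW : ∀ l : ℝ, 0 ≤ l → ∑ k ∈ box d (radius u C₀ α₀ m l), |leadingWeight u m k| ≤
      W * (2 * l + 1) ^ (d + ∑ i, m i))
    (hu : ExpDecay u C α) (hμ : HasDensity μ ρ) (hρ : IsBV ρ) (hl : 0 ≤ l) (hI : I.OrdConnected)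
    (hIb : Bornology.IsBounded I) (hω : ∀ x, Summable fun k => ω k * u (x - k))
    (hΓ : box d (radius u C α m l) ⊆ Γ) :
    ∫ η : Γ → ℝ, traceProj u (glue Γ η ω) (box d l) I ∂(Measure.pi fun _ : Γ => μ) ≤
      W * varNorm ρ * volume.real I * (2 * l + 1) ^ (2 * d + ∑ i, m i) := by
  have hvar := hρ.varNorm_nonneg
  calc _ ≤ (box d l).card * volume.real I *
        ((∑ k ∈ box d (radius u C₀ α₀ m l), |leadingWeight u m k|) * varNorm ρ) :=
        hm.integral_traceProj_le_sum_box_of_expDecay hu₀ hu hμ hρ hl hI hIb hω hΓ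
    _ ≤ (2 * l + 1) ^ d * volume.real I *
        (W * (2 * l + 1) ^ (d + ∑ i, m i) * varNorm ρ) := by
        gcongr
        · exact card_box_le hl
        · exact hW l hl
    _ = W * varNorm ρ * volume.real I * (2 * l + 1) ^ (2 * d + ∑ i, m i) := by ring

end Wegner

end AlloyWegner

end

theorem theorem2p3_general {d : ℕ} (u : (Fin d → ℤ) → ℝ) (hu : u ≠ 0)
    (hdecay : ∃ C α, ExpDecay u C α) :
    (∃ I₀, IsLeadingIndex u I₀) ∧
    ∃ C_W : ℝ, 0 < C_W ∧
      ∀ (C α : ℝ) (I₀ : Fin d → ℕ), ExpDecay u C α → IsLeadingIndex u I₀ →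
      ∀ (μ : Measure ℝ) [IsProbabilityMeasure μ] (ρ : ℝ → ℝ), HasDensity μ ρ → IsBV ρ →
      ∀ (l : ℝ), 0 ≤ l →
      ∀ (I : Set ℝ), I.OrdConnected → Bornology.IsBounded I →
      ∀ (ω : (Fin d → ℤ) → ℝ), (∀ x, Summable fun k => ω k * u (x - k)) →
      ∀ (Γ : Finset (Fin d → ℤ)), box d (radius u C α I₀ l) ⊆ Γ →
        Integrable (fun η : Γ → ℝ => traceProj u (glue Γ η ω) (box d l) I)
          (Measure.pi fun _ : Γ => μ) ∧
        ∫ η : Γ → ℝ, traceProj u (glue Γ η ω) (box d l) I ∂(Measure.pi fun _ : Γ => μ) ≤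
          C_W * varNorm ρ * volume.real I * (2 * l + 1) ^ (2 * d + ∑ i, I₀ i) := by
  obtain ⟨C₀, α₀, hu₀⟩ := hdecay
  refine ⟨exists_isLeadingIndex hu hu₀, ?_⟩
  choose W hW_nonneg hW using exists_sum_box_abs_leadingWeight_le u C₀ α₀
  have hfin := finite_setOf_isLeadingIndex u
  have hsum : 0 ≤ ∑ m ∈ hfin.toFinset, W m := Finset.sum_nonneg fun m _ => hW_nonneg m
  refine ⟨1 + ∑ m ∈ hfin.toFinset, W m, by positivity, ?_⟩
  intro C α I₀ hdec hI₀ μ _ ρ hμ hρ l hl I hI hIb ω hω Γ hΓ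
  refine ⟨integrable_traceProj hω hI.measurableSet, ?_⟩
  have hW_le : W I₀ ≤ ∑ m ∈ hfin.toFinset, W m :=
    Finset.single_le_sum (fun m _ => hW_nonneg m) (hfin.mem_toFinset.2 hI₀)
  have hvar := hρ.varNorm_nonneg
  refine (hI₀.integral_traceProj_le_mul_pow hu₀ (hW I₀) hdec hμ hρ hl hI hIb hω hΓ).trans ?_
  gcongr
  linarith

theorem theorem2p3 {d : ℕ} (u : (Fin d → ℤ) → ℝ) (hu : u ≠ 0) (hdecay : ∃ C α, ExpDecay u C α) :
    (∃ I₀, IsLeadingIndex u I₀) ∧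
    ∃ C_W : ℝ, 0 < C_W ∧
      ∀ (C α : ℝ) (I₀ : Fin d → ℕ), ExpDecay u C α → IsLeadingIndex u I₀ →
      ∀ (μ : Measure ℝ) [IsProbabilityMeasure μ] (ρ : ℝ → ℝ),
        Bornology.IsBounded μ.support → HasDensity μ ρ → IsBV ρ →
      ∀ (l : ℝ), 0 < l →
      ∀ (I : Set ℝ), I.OrdConnected → Bornology.IsBounded I →
      -- the couplings outside `Γ` are fixed, and arbitrary as long as `v_ω` is defined
      ∀ (ω : (Fin d → ℤ) → ℝ), (∀ x, Summable fun k => ω k * u (x - k)) →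
      ∀ (Γ : Finset (Fin d → ℤ)), Γ = box d (radius u C α I₀ l) →
        Integrable (fun η : Γ → ℝ => traceProj u (glue Γ η ω) (box d l) I)
          (Measure.pi fun _ : Γ => μ) ∧
        ∫ η : Γ → ℝ, traceProj u (glue Γ η ω) (box d l) I ∂(Measure.pi fun _ : Γ => μ) ≤
          C_W * varNorm ρ * volume.real I * (2 * l + 1) ^ (2 * d + ∑ i, I₀ i) := by
  obtain ⟨hlead, C_W, hC_W, hbound⟩ := theorem2p3_general u hu hdecay
  exact ⟨hlead, C_W, hC_W, fun C α I₀ hdec hI₀ μ _ ρ _ hμ hρ l hl I hI hIb ω hω Γ hΓ =>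
    hbound C α I₀ hdec hI₀ μ ρ hμ hρ l hl.le I hI hIb ω hω Γ hΓ.ge⟩
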